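/- Assume $V$ satisfies $\mathrm{ZFC}$. For a class $X$, let $OD(X)$ be the class of all sets $a$ such that $a$ is the unique set satisfying $\varphi(a, p_1,\dots,p_n)$ in $(V,\in)$ for some first-order formula $\varphi$ of the language of set theory and some parameters $p_1,\dots,p_n$, each of which is an ordinal or an element of $X$. Let $HOD(X)$ be the class of all sets $a$ such that $\mathrm{tcl}(\{a\}) \subseteq OD(X)$, where $\mathrm{tcl}$ denotes the transitive closure. An inner model is a transitive class $M$ that contains all ordinals, is a model of $\mathrm{ZF}$, and is a class of $V$ in the sense that the axioms of $\mathrm{ZF}$ remain valid in $V$ for formulas with an additional unary predicate interpreted by $M$. For a class $M$ let $M^\omega$ be the class of all functions in $V$ from $\omega$ to $M$. (a) If $M$ is an inner model, then $HOD(M^\omega)$ satisfies dependent choice. (b) $HOD(P(\omega))$ satisfies dependent choice. Here a class $H$ satisfies dependent choice if the following holds in the structure $(H,\in)$: whenever $A$ is a nonempty set and $R$ is a relation such that for every $x \in A$ there is $y \in A$ with $y\,R\,x$, there is a function $f : \omega \to A$ such that $f(n+1)\,R\,f(n)$ for all $n \in \omega$. -/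

import Mathlib

open FirstOrder

universe u

/-! The universe `V` is Mathlib's type `ZFSet` of sets, and a class is a `Set ZFSet`. -/

namespace HODModels

/-! ### The language of set theory and its structures -/

/-- The only non-logical symbol of the language of set theory: the binary symbol `∈`. -/
inductive MemRel : ℕ → Type
  | mem : MemRel 2

/-- The first-order language of set theory. -/
def memLang : FirstOrder.Language.{0, 0} := ⟨fun _ => Empty, MemRel⟩

/-- A binary relation `E` on `N`, as a structure for the language of set theory. -/
@[reducible] def memStructure {N : Type*} (E : N → N → Prop) : memLang.Structure N where
  funMap f := f.elim
  RelMap | .mem => fun v => E (v 0) (v 1)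

/-- `S` is definable in `(N, E)` by a first-order formula with parameters from `P`. -/
def DefinableClass {N : Type*} (E : N → N → Prop) (P : Set N) (S : Set N) : Prop :=
  letI := memStructure E
  P.Definable₁ memLang S

/-- The binary relation `F` is definable in `(N, E)` by a first-order formula with
parameters from `P`. -/
def DefinableRel {N : Type*} (E : N → N → Prop) (P : Set N) (F : Set (N × N)) : Prop :=
  letI := memStructure E
  P.Definable₂ memLang F

/-- The membership relation restricted to a class `A`. -/
def memOn (A : Set ZFSet.{u}) : A → A → Prop := fun x y => (x : ZFSet.{u}) ∈ (y : ZFSet.{u})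

/-! ### Set-theoretic notions inside a structure `(N, E)` -/

section Internal

variable {N : Type*} (E : N → N → Prop)

/-- `(N, E)` satisfies `e = ∅`. -/
def IsEmptySet (e : N) : Prop := ∀ x, ¬ E x e

/-- `(N, E)` satisfies `t = s ∪ {s}`. -/
def IsSucc (t s : N) : Prop := ∀ x, E x t ↔ E x s ∨ x = s

/-- `(N, E)` satisfies: `a` contains `∅` and is closed under `s ↦ s ∪ {s}`. -/
def IsInductive (a : N) : Prop :=
  (∃ e, E e a ∧ IsEmptySet E e) ∧ ∀ s, E s a → ∃ t, E t a ∧ IsSucc E t s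

/-- `(N, E)` satisfies `w = ω` (the least inductive set). -/
def IsOmega (w : N) : Prop :=
  IsInductive E w ∧ ∀ a, IsInductive E a → ∀ x, E x w → E x a

/-- `(N, E)` satisfies `p = (x, y) = {{x}, {x, y}}`. -/
def IsPair (p x y : N) : Prop :=
  ∃ s d, (∀ z, E z s ↔ z = x) ∧ (∀ z, E z d ↔ z = x ∨ z = y) ∧ ∀ z, E z p ↔ z = s ∨ z = d

/-- `(N, E)` satisfies `(x, y) ∈ r`. -/
def PairMem (x y r : N) : Prop := ∃ p, E p r ∧ IsPair E p x y

/-- `(N, E)` satisfies: `f` is a function from `a` to `b`. -/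
def IsFunction (f a b : N) : Prop :=
  (∀ p, E p f → ∃ x y, E x a ∧ E y b ∧ IsPair E p x y) ∧ ∀ x, E x a → ∃! y, PairMem E x y f

/-- `(N, E)` is a model of `ZF`. In the two schemes, formulas may have arbitrary parameters
from `N`. -/
structure ModelsZF : Prop where
  extensionality : ∀ a b, (∀ x, E x a ↔ E x b) → a = b
  foundation : ∀ a, (∃ x, E x a) → ∃ x, E x a ∧ ∀ y, E y x → ¬ E y a
  pairing : ∀ a b, ∃ c, ∀ x, E x c ↔ x = a ∨ x = b
  union : ∀ a, ∃ b, ∀ x, E x b ↔ ∃ y, E y a ∧ E x y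
  powerset : ∀ a, ∃ b, ∀ x, E x b ↔ ∀ y, E y x → E y a
  infinity : ∃ a, IsInductive E a
  separation : ∀ S : Set N, DefinableClass E Set.univ S →
    ∀ a, ∃ b, ∀ x, E x b ↔ E x a ∧ x ∈ S
  replacement : ∀ F : Set (N × N), DefinableRel E Set.univ F →
    ∀ a, (∀ x, E x a → ∀ y y', (x, y) ∈ F → (x, y') ∈ F → y = y') →
      ∃ b, ∀ y, E y b ↔ ∃ x, E x a ∧ (x, y) ∈ F

/-- `(N, E)` satisfies dependent choice: if `a` is a nonempty set and `r` is a relation such that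
every `x ∈ a` has some `y ∈ a` with `y r x`, then there is a sequence `f : ω → a` such that
`f (n + 1) r f n` for all `n ∈ ω`. -/
def SatisfiesDC : Prop :=
  ∀ a r : N, (∃ x, E x a) → (∀ x, E x a → ∃ y, E y a ∧ PairMem E y x r) →
    ∃ w f, IsOmega E w ∧ IsFunction E f w a ∧
      ∀ n m x y, E n w → IsSucc E m n → PairMem E n x f → PairMem E m y f → PairMem E y x r

end Internal

/-! ### Inner models -/

/-- Every class `M`, definable or not, can be used in instances of replacement (and hence of
separation) in the universe: this holds for arbitrary class relations `F`. -/
theorem class_replacement (F : ZFSet.{u} → ZFSet.{u} → Prop) (a : ZFSet.{u})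
    (hF : ∀ x ∈ a, ∀ y y', F x y → F x y' → y = y') :
    ∃ b : ZFSet.{u}, ∀ y, y ∈ b ↔ ∃ x ∈ a, F x y := by
  classical
  let b₀ : ZFSet.{u} := @ZFSet.image (fun x => if h : ∃ y, F x y then h.choose else ∅)
    (Classical.allZFSetDefinable _) a
  refine ⟨b₀.sep fun y => ∃ x ∈ a, F x y, fun y => ?_⟩
  rw [ZFSet.mem_sep]
  refine ⟨fun h => h.2, fun h => ⟨?_, h⟩⟩
  obtain ⟨x, hx, hxy⟩ := h
  have hex : ∃ y, F x y := ⟨y, hxy⟩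
  refine (@ZFSet.mem_image _ (Classical.allZFSetDefinable _) _ _).2 ⟨x, hx, ?_⟩
  rw [dif_pos hex]
  exact hF x hx _ _ hex.choose_spec hxy

/-- `M` is an inner model of `ZF`: a transitive class containing all ordinals and satisfying `ZF`.
(That the axioms of `ZF` remain valid in the universe for formulas with a predicate for `M` is
automatic, by `class_replacement`.) -/
structure IsInnerModel (M : Set ZFSet.{u}) : Prop where
  transitive : ∀ x ∈ M, ∀ y ∈ x, y ∈ M
  ordinals : ∀ x : ZFSet.{u}, x.IsOrdinal → x ∈ M
  modelsZF : ModelsZF (memOn M)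

/-! ### Relative (hereditary) ordinal definability -/

/-- `OD(X)`: the sets `a` such that `{a}` is definable in the universe `(V, ∈)` by a formula whose
parameters are ordinals and elements of `X`. -/
def OD (X : Set ZFSet.{u}) : Set ZFSet.{u} :=
  {a | DefinableClass (fun x y : ZFSet.{u} => x ∈ y) ({x | x.IsOrdinal} ∪ X) {a}}

/-- The transitive closure of `x`: the elements of every transitive set that includes `x`. -/
def tcl (x : ZFSet.{u}) : Set ZFSet.{u} :=
  {b | ∀ t : ZFSet.{u}, t.IsTransitive → x ⊆ t → b ∈ t}

/-- `HOD(X)`: the sets `a` such that `tcl({a}) ⊆ OD(X)`. -/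
def HOD (X : Set ZFSet.{u}) : Set ZFSet.{u} :=
  {a | tcl {a} ⊆ OD X}

/-- `M^ω`: the class of all functions (in the universe) from `ω` to `M`. -/
def omegaSeq (M : Set ZFSet.{u}) : Set ZFSet.{u} :=
  {f | ∃ y : ZFSet.{u}, (∀ z ∈ y, z ∈ M) ∧ ZFSet.IsFunc ZFSet.omega y f}

/-- `P(ω)`, as a class. -/
def powersetOmega : Set ZFSet.{u} := {x | x ∈ ZFSet.powerset ZFSet.omega}

end HODModels

/-!
A set in `OD(X)` is definable from ordinals and a single sequence of elements of `X`. If every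
sequence of elements of `X` can be recovered from one element of `X`, as is the case for `M^ω` and
for `P(ω)` by pairing natural numbers, then each set in `OD(X)` belongs to `OD({t})` for some
`t ∈ X`. By the reflection principle, a set in `OD({t})` is defined from `t` in some `(V_α, ∈)`,
since the least ordinal parameters for which this fails would themselves be definable. Such
definitions are well-ordered by `α` and a Gödel number, which gives, uniformly in `t`, a definable
choice of an element of any set that meets `OD({t})`. Given a relation in `HOD(X)`, choose in `V`
parameters `t n ∈ X` for the successive steps; the sequence of the `t n` is again definable from an
element of `X`, and the sequence obtained by making the definable choices is definable from it.
-/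

namespace HODModels

section Definability

/-- The universe of sets, as a structure for the language of set theory. -/
instance universeStructure : memLang.Structure ZFSet.{u} := memStructure fun x y => x ∈ y

/-- The relation `P` is definable in the universe with parameters from `B`. A relation is a
predicate on assignments of sets to variables, and this is a class in order that definability of
compound relations can be found by instance search. -/
class DefinablePred (B : Set ZFSet.{u}) {ι : Type} (P : (ι → ZFSet.{u}) → Prop) : Prop where
  definable : B.Definable memLang {v | P v}

/-- The function `f` is definable in the universe with parameters from `B`. -/
class DefinableFun (B : Set ZFSet.{u}) {ι : Type} (f : (ι → ZFSet.{u}) → ZFSet.{u}) : Prop where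
  definableFun : B.DefinableFun memLang f

variable {B : Set ZFSet.{u}} {ι κ : Type} {P Q : (ι → ZFSet.{u}) → Prop}
  {f g : (ι → ZFSet.{u}) → ZFSet.{u}}

theorem DefinablePred.congr (h : DefinablePred B P) (hPQ : ∀ v, P v ↔ Q v) :
    DefinablePred B Q := by
  rwa [← funext fun v => propext (hPQ v)]

theorem DefinablePred.comp (h : DefinablePred B P) (c : ι → κ) :
    DefinablePred B fun v : κ → ZFSet.{u} => P fun i => v (c i) :=
  ⟨h.definable.preimage_comp c⟩

theorem DefinableFun.comp (h : DefinableFun B f) (c : ι → κ) :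
    DefinableFun B fun v : κ → ZFSet.{u} => f fun i => v (c i) :=
  ⟨h.definableFun.preimage_comp (Option.map c)⟩

theorem DefinablePred.subst [Finite κ] {Q : (κ → ZFSet.{u}) → Prop} (hQ : DefinablePred B Q)
    {f : κ → (ι → ZFSet.{u}) → ZFSet.{u}} (hf : ∀ k, DefinableFun B (f k)) :
    DefinablePred B fun v => Q fun k => f k v :=
  ⟨Set.Definable.preimage_map (F := fun v k => f k v) (fun k => (hf k).definableFun) hQ.definable⟩

theorem DefinableFun.subst [Finite κ] {F : (κ → ZFSet.{u}) → ZFSet.{u}} (hF : DefinableFun B F)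
    {f : κ → (ι → ZFSet.{u}) → ZFSet.{u}} (hf : ∀ k, DefinableFun B (f k)) :
    DefinableFun B fun v => F fun k => f k v :=
  ⟨Set.DefinableFun.comp (g := fun v k => f k v) (fun k => (hf k).definableFun) hF.definableFun⟩

instance DefinableFun.var (i : ι) : DefinableFun B fun v : ι → ZFSet.{u} => v i :=
  ⟨Set.DefinableFun.proj memLang⟩

theorem DefinableFun.const {a : ZFSet.{u}} (ha : a ∈ B) :
    DefinableFun B fun _ : ι → ZFSet.{u} => a :=
  ⟨memLang.definableFun_const ι ha⟩

theorem definablePred_mem_var (i j : ι) :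
    DefinablePred B fun v : ι → ZFSet.{u} => v i ∈ v j := by
  refine ⟨(Set.empty_definable_iff (L := memLang).2
    ⟨Language.Relations.formula₂ (L := memLang) MemRel.mem (.var i) (.var j), ?_⟩).mono
      (Set.empty_subset B)⟩
  ext v
  exact (Language.Formula.realize_rel₂ (L := memLang) (M := ZFSet.{u})
    (R := MemRel.mem) (t₁ := .var i) (t₂ := .var j)).symm

instance DefinablePred.eq [hf : DefinableFun B f] [hg : DefinableFun B g] :
    DefinablePred B fun v => f v = g v :=
  ⟨hf.definableFun.ofPred_eq hg.definableFun⟩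

instance DefinablePred.mem [hf : DefinableFun B f] [hg : DefinableFun B g] :
    DefinablePred B fun v => f v ∈ g v :=
  (definablePred_mem_var (0 : Fin 2) 1).subst (f := ![f, g]) (Fin.forall_fin_two.2 ⟨hf, hg⟩)

instance DefinablePred.not [hP : DefinablePred B P] : DefinablePred B fun v => ¬ P v :=
  ⟨hP.definable.compl⟩

instance DefinablePred.and [hP : DefinablePred B P] [hQ : DefinablePred B Q] :
    DefinablePred B fun v => P v ∧ Q v :=
  ⟨hP.definable.inter hQ.definable⟩

instance DefinablePred.or [hP : DefinablePred B P] [hQ : DefinablePred B Q] :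
    DefinablePred B fun v => P v ∨ Q v :=
  ⟨hP.definable.union hQ.definable⟩

instance DefinablePred.imp [DefinablePred B P] [DefinablePred B Q] :
    DefinablePred B fun v => P v → Q v :=
  (inferInstance : DefinablePred B fun v => ¬ P v ∨ Q v).congr fun _ => imp_iff_not_or.symm

instance DefinablePred.iff [DefinablePred B P] [DefinablePred B Q] :
    DefinablePred B fun v => (P v ↔ Q v) :=
  (inferInstance : DefinablePred B fun v => (P v → Q v) ∧ (Q v → P v)).congr
    fun _ => iff_iff_implies_and_implies.symm

instance DefinablePred.exists {R : (ι → ZFSet.{u}) → ZFSet.{u} → Prop}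
    [h : DefinablePred B fun w : Option ι → ZFSet.{u} => R (fun i => w (some i)) (w none)] :
    DefinablePred B fun v => ∃ x, R v x := by
  have hR := h.comp (κ := ι ⊕ Unit) fun o => o.elim (.inr ()) .inl
  have hex : DefinablePred B fun v => ∃ x : Unit → ZFSet.{u}, R v (x ()) :=
    ⟨Set.Definable.exists_of_finite hR.definable⟩
  exact hex.congr fun v => ⟨fun ⟨x, hx⟩ => ⟨x (), hx⟩, fun ⟨x, hx⟩ => ⟨fun _ => x, hx⟩⟩

instance DefinablePred.forall {R : (ι → ZFSet.{u}) → ZFSet.{u} → Prop}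
    [DefinablePred B fun w : Option ι → ZFSet.{u} => R (fun i => w (some i)) (w none)] :
    DefinablePred B fun v => ∀ x, R v x :=
  haveI : DefinablePred B fun w : Option ι → ZFSet.{u} => ¬ R (fun i => w (some i)) (w none) :=
    .not
  (inferInstance : DefinablePred B fun v => ¬ ∃ x, ¬ R v x).congr fun _ => not_exists_not

theorem DefinableFun.of_eq_iff {R : ZFSet.{u} → (ι → ZFSet.{u}) → Prop}
    (hf : ∀ v x, x = f v ↔ R x v)
    [h : DefinablePred B fun v : Option ι → ZFSet.{u} => R (v none) fun i => v (some i)] :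
    DefinableFun B f :=
  have hgraph : DefinablePred B fun v : Option ι → ZFSet.{u} => f (fun i => v (some i)) = v none :=
    h.congr fun _ => (hf _ _).symm.trans eq_comm
  ⟨hgraph.definable⟩

theorem DefinableFun.of_mem_iff {R : ZFSet.{u} → (ι → ZFSet.{u}) → Prop}
    (hf : ∀ v x, x ∈ f v ↔ R x v)
    [h : DefinablePred B fun v : Option ι → ZFSet.{u} => R (v none) fun i => v (some i)] :
    DefinableFun B f := by
  have hR : DefinablePred B fun w : Option (Option ι) → ZFSet.{u} =>
      R (w none) fun i => w (some (some i)) :=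
    h.comp fun o => o.elim none fun i => some (some i)
  have hmem : DefinablePred B fun w : Option (Option ι) → ZFSet.{u} =>
      w none ∈ w (some none) ↔ R (w none) fun i => w (some (some i)) := .iff
  have hall : DefinablePred B fun v : Option ι → ZFSet.{u} =>
      ∀ y, y ∈ v none ↔ R y fun i => v (some i) := .forall
  exact .of_eq_iff (R := fun x v => ∀ y, y ∈ x ↔ R y v) fun _ _ => by
    simp only [ZFSet.ext_iff, hf]

theorem DefinablePred.subst₁ {Q : ZFSet.{u} → Prop}
    (hQ : DefinablePred B fun v : Fin 1 → ZFSet.{u} => Q (v 0)) (hf : DefinableFun B f) :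
    DefinablePred B fun v => Q (f v) :=
  hQ.subst (f := fun _ => f) fun _ => hf

theorem DefinablePred.subst₂ {Q : ZFSet.{u} → ZFSet.{u} → Prop}
    (hQ : DefinablePred B fun v : Fin 2 → ZFSet.{u} => Q (v 0) (v 1))
    (hf : DefinableFun B f) (hg : DefinableFun B g) : DefinablePred B fun v => Q (f v) (g v) :=
  hQ.subst (f := ![f, g]) (by simp [Fin.forall_fin_succ, hf, hg])

theorem DefinablePred.subst₃ {Q : ZFSet.{u} → ZFSet.{u} → ZFSet.{u} → Prop}
    (hQ : DefinablePred B fun v : Fin 3 → ZFSet.{u} => Q (v 0) (v 1) (v 2))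
    {h : (ι → ZFSet.{u}) → ZFSet.{u}}
    (hf : DefinableFun B f) (hg : DefinableFun B g) (hh : DefinableFun B h) :
    DefinablePred B fun v => Q (f v) (g v) (h v) :=
  hQ.subst (f := ![f, g, h]) (by simp [Fin.forall_fin_succ, hf, hg, hh])

theorem DefinablePred.subst₄ {Q : ZFSet.{u} → ZFSet.{u} → ZFSet.{u} → ZFSet.{u} → Prop}
    (hQ : DefinablePred B fun v : Fin 4 → ZFSet.{u} => Q (v 0) (v 1) (v 2) (v 3))
    {h k : (ι → ZFSet.{u}) → ZFSet.{u}} (hf : DefinableFun B f) (hg : DefinableFun B g)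
    (hh : DefinableFun B h) (hk : DefinableFun B k) :
    DefinablePred B fun v => Q (f v) (g v) (h v) (k v) :=
  hQ.subst (f := ![f, g, h, k]) (by simp [Fin.forall_fin_succ, hf, hg, hh, hk])

theorem DefinableFun.subst₂ {F : ZFSet.{u} → ZFSet.{u} → ZFSet.{u}}
    (hF : DefinableFun B fun v : Fin 2 → ZFSet.{u} => F (v 0) (v 1))
    (hf : DefinableFun B f) (hg : DefinableFun B g) : DefinableFun B fun v => F (f v) (g v) :=
  hF.subst (f := ![f, g]) (by simp [Fin.forall_fin_succ, hf, hg])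

instance DefinableFun.ite {p : (ι → ZFSet.{u}) → Prop} [DecidablePred p]
    [hp : DefinablePred B p] [hf : DefinableFun B f] [hg : DefinableFun B g] :
    DefinableFun B fun v => if p v then f v else g v :=
  ⟨Set.DefinableFun.ite hp.definable hf.definableFun hg.definableFun⟩

instance DefinableFun.empty : DefinableFun B fun _ : ι → ZFSet.{u} => ∅ :=
  .of_mem_iff (R := fun x _ => x ≠ x) (by simp)

instance DefinableFun.insert [hf : DefinableFun B f] [hg : DefinableFun B g] :
    DefinableFun B fun v => insert (f v) (g v) :=
  .subst₂ (F := fun x y => Insert.insert x y)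
    (.of_mem_iff (R := fun x v => x = v 0 ∨ x ∈ v 1) (by simp)) hf hg

instance DefinableFun.singleton [DefinableFun B f] :
    DefinableFun B fun v => ({f v} : ZFSet.{u}) := by
  simpa only [LawfulSingleton.insert_empty_eq] using
    (inferInstance : DefinableFun B fun v => Insert.insert (f v) (∅ : ZFSet.{u}))

instance DefinableFun.pair [DefinableFun B f] [DefinableFun B g] :
    DefinableFun B fun v => ZFSet.pair (f v) (g v) :=
  (inferInstance : DefinableFun B fun v => {{f v}, {f v, g v}})

instance DefinablePred.subset [hf : DefinableFun B f] [hg : DefinableFun B g] :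
    DefinablePred B fun v => f v ⊆ g v :=
  .subst₂ (Q := fun x y => x ⊆ y)
    ((inferInstance : DefinablePred B fun v : Fin 2 → ZFSet.{u} => ∀ x, x ∈ v 0 → x ∈ v 1).congr
      fun _ => by simp only [ZFSet.subset_def]) hf hg

instance DefinablePred.isOrdinal [hf : DefinableFun B f] :
    DefinablePred B fun v => (f v).IsOrdinal :=
  .subst₁ ((inferInstance : DefinablePred B fun v : Fin 1 → ZFSet.{u} => (∀ y, y ∈ v 0 → y ⊆ v 0) ∧
      ∀ y z w, y ∈ z → z ∈ w → w ∈ v 0 → y ∈ w).congr fun _ =>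
        ⟨fun h => ⟨h.1, h.2 _ _ _⟩, fun h => ⟨h.1, fun _ _ _ => h.2⟩⟩) hf

end Definability

section DefinableClosure

variable {A B : Set ZFSet.{u}} {a : ZFSet.{u}} {ι κ : Type}

theorem DefinablePred.mono {P : (ι → ZFSet.{u}) → Prop} (h : DefinablePred A P) (hAB : A ⊆ B) :
    DefinablePred B P :=
  ⟨h.definable.mono hAB⟩

/-- The definable closure of `B`: the sets that are definable in the universe with parameters
from `B`. -/
def dcl (B : Set ZFSet.{u}) : Set ZFSet.{u} :=
  {a | DefinableClass (fun x y : ZFSet.{u} => x ∈ y) B {a}}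

theorem OD_eq_dcl (X : Set ZFSet.{u}) : OD X = dcl ({x | x.IsOrdinal} ∪ X) := rfl

theorem mem_dcl_iff_definablePred :
    a ∈ dcl B ↔ DefinablePred B fun v : Fin 1 → ZFSet.{u} => v 0 = a :=
  ⟨fun h => ⟨h⟩, fun h => h.definable⟩

theorem mem_dcl_of_forall_iff {P : ZFSet.{u} → Prop} (hP : ∀ x, P x ↔ x = a)
    [h : DefinablePred B fun v : Fin 1 → ZFSet.{u} => P (v 0)] : a ∈ dcl B :=
  mem_dcl_iff_definablePred.2 (h.congr fun v => hP (v 0))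

theorem mem_dcl_iff_definableFun : a ∈ dcl B ↔ DefinableFun B fun _ : ι → ZFSet.{u} => a := by
  rw [mem_dcl_iff_definablePred]
  refine ⟨fun h => .of_eq_iff (R := fun x _ => x = a) (fun _ _ => Iff.rfl) (h := ?_), fun h => ?_⟩
  · exact h.comp fun _ => none
  · have hgraph : DefinablePred B fun v : Option ι → ZFSet.{u} => a = v none := ⟨h.definableFun⟩
    exact (hgraph.comp (κ := Fin 1) fun _ => 0).congr fun _ => eq_comm

theorem subset_dcl : B ⊆ dcl B := fun _ ha =>
  mem_dcl_iff_definableFun.2 (DefinableFun.const (ι := Empty) ha)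

theorem dcl_mono (hAB : A ⊆ B) : dcl A ⊆ dcl B := fun _ h => Set.Definable.mono h hAB

theorem mem_dcl_iff_exists_finset :
    a ∈ dcl B ↔ ∃ s : Finset ZFSet.{u}, ↑s ⊆ B ∧ a ∈ dcl (s : Set ZFSet.{u}) :=
  Set.definable_iff_finitely_definable

theorem DefinableFun.mem_dcl [Finite ι] {f : (ι → ZFSet.{u}) → ZFSet.{u}} (hf : DefinableFun B f)
    {p : ι → ZFSet.{u}} (hp : ∀ i, p i ∈ dcl B) : f p ∈ dcl B :=
  mem_dcl_iff_definableFun.2 <|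
    hf.subst (ι := Empty) (f := fun i _ => p i) fun i => mem_dcl_iff_definableFun.1 (hp i)

theorem dcl_subset_dcl (hAB : A ⊆ dcl B) : dcl A ⊆ dcl B := by
  intro a ha
  obtain ⟨s, hsA, has⟩ := mem_dcl_iff_exists_finset.1 ha
  obtain ⟨φ, hφ⟩ := Set.definable_iff_exists_formula_sum.1 has
  have hR : B.Definable memLang (Set.ofPred φ.Realize) :=
    (Set.empty_definable_iff.2 ⟨φ, rfl⟩).mono (Set.empty_subset B)
  have hconst : B.DefinableMap memLang fun v : Fin 1 → ZFSet.{u} =>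
      Sum.elim (fun x : (s : Set ZFSet.{u}) => (x : ZFSet.{u})) v :=
    Sum.rec (fun x => (mem_dcl_iff_definableFun.1 (hAB (hsA x.2))).definableFun)
      fun i => (DefinableFun.var i).definableFun
  refine mem_dcl_iff_definablePred.2 ((DefinablePred.mk (hR.preimage_map hconst)).congr fun v => ?_)
  exact (Set.ext_iff.1 hφ v).symm

theorem exists_definablePred_of_mem_dcl_insert {p : ZFSet.{u}} (ha : a ∈ dcl (insert p B)) :
    ∃ R : ZFSet.{u} → ZFSet.{u} → Prop,
      DefinablePred B (fun v : Fin 2 → ZFSet.{u} => R (v 0) (v 1)) ∧ ∀ x, R p x ↔ x = a := by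
  classical
  obtain ⟨φ, hφ⟩ := Set.definable_iff_exists_formula_sum.1 ha
  let R (q x : ZFSet.{u}) : Prop :=
    φ.Realize (Sum.elim (fun b => if (b : ZFSet.{u}) = p then q else b) fun _ => x)
  let c : (insert p B : Set ZFSet.{u}) ⊕ Fin 1 → B ⊕ Fin 2 := Sum.elim
    (fun b => if h : (b : ZFSet.{u}) = p then .inr 0 else .inl ⟨b, b.2.resolve_left h⟩)
    fun _ => .inr 1
  refine ⟨R, ⟨Set.definable_iff_exists_formula_sum.2 ⟨φ.relabel c, ?_⟩⟩, fun x => ?_⟩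
  · ext v
    refine Iff.trans (iff_of_eq (congrArg φ.Realize (funext ?_)))
      Language.Formula.realize_relabel.symm
    rintro (b | i)
    · by_cases hb : (b : ZFSet.{u}) = p <;> simp [c, hb]
    · rfl
  · refine Iff.trans (iff_of_eq (congrArg φ.Realize ?_)) (Set.ext_iff.1 hφ fun _ => x).symm
    congr 1
    ext b
    split_ifs with hb <;> simp [hb]

end DefinableClosure

section OrdinalParameters

variable {B C : Set ZFSet.{u}}

theorem exists_ordinal_mem_dcl {P : ZFSet.{u} → Prop}
    (hP : DefinablePred B fun v : Fin 1 → ZFSet.{u} => P (v 0))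
    (hex : ∃ α : ZFSet.{u}, α.IsOrdinal ∧ P α) : ∃ α ∈ dcl B, α.IsOrdinal ∧ P α := by
  obtain ⟨α, hα, hmin⟩ := ZFSet.mem_wf.has_min {x | x.IsOrdinal ∧ P x} hex
  refine ⟨α, ?_, hα⟩
  have hP' : DefinablePred B fun v : Option (Fin 1) → ZFSet.{u} => P (v none) :=
    hP.comp fun _ => none
  refine mem_dcl_of_forall_iff (P := fun x => (x.IsOrdinal ∧ P x) ∧
    ∀ y, y ∈ x → ¬ (y.IsOrdinal ∧ P y)) fun x => ⟨fun ⟨hx, hxmin⟩ => ?_, ?_⟩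
  · rcases hα.1.mem_trichotomous hx.1 with h | h | h
    · exact absurd hα (hxmin α h)
    · exact h.symm
    · exact absurd h (hmin x hx)
  · rintro rfl
    exact ⟨hα, fun y hyx hy => hmin y hy hyx⟩

theorem dcl_insert_subset_of_isOrdinal
    (hC : DefinablePred B fun v : Fin 1 → ZFSet.{u} => v 0 ∈ C)
    (hBC : dcl B ⊆ C) {α : ZFSet.{u}} (hα : α.IsOrdinal) : dcl (insert α B) ⊆ C := by
  intro a ha
  by_contra haC
  obtain ⟨R, hR, hRα⟩ := exists_definablePred_of_mem_dcl_insert ha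
  have hR' {ι : Type} {f g : (ι → ZFSet.{u}) → ZFSet.{u}} [DefinableFun B f] [DefinableFun B g] :
      DefinablePred B fun v => R (f v) (g v) := hR.subst₂ ‹_› ‹_›
  have hC' {ι : Type} {f : (ι → ZFSet.{u}) → ZFSet.{u}} [DefinableFun B f] :
      DefinablePred B fun v => f v ∈ C := hC.subst₁ ‹_›
  obtain ⟨β, hβ, -, x, hx, hxC⟩ := exists_ordinal_mem_dcl (B := B)
    (P := fun α => ∃ x, (∀ y, R α y ↔ y = x) ∧ x ∉ C) inferInstance ⟨α, hα, a, hRα, haC⟩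
  have := mem_dcl_iff_definableFun (ι := Fin 1).1 hβ
  exact hxC (hBC (mem_dcl_of_forall_iff hx))

theorem dcl_ordinals_union_subset (hC : DefinablePred B fun v : Fin 1 → ZFSet.{u} => v 0 ∈ C)
    (hBC : dcl B ⊆ C) : dcl ({x | x.IsOrdinal} ∪ B) ⊆ C := by
  classical
  have hfinite (s : Finset ZFSet.{u}) (hs : ∀ α ∈ s, α.IsOrdinal) : dcl (↑s ∪ B) ⊆ C := by
    induction s using Finset.induction_on with
    | empty => simpa using hBC
    | insert α s _ ih =>
      rw [Finset.coe_insert, Set.insert_union]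
      exact dcl_insert_subset_of_isOrdinal (hC.mono Set.subset_union_right)
        (ih fun β hβ => hs β (Finset.mem_insert_of_mem hβ)) (hs α (Finset.mem_insert_self α s))
  intro a ha
  obtain ⟨s, hs, has⟩ := mem_dcl_iff_exists_finset.1 ha
  refine hfinite (s.filter fun x => x.IsOrdinal) (fun α hα => (Finset.mem_filter.1 hα).2)
    (dcl_mono (fun x hx => ?_) has)
  rcases hs hx with h | h
  · exact .inl (Finset.mem_coe.2 (Finset.mem_filter.2 ⟨hx, h⟩))
  · exact .inr h

end OrdinalParameters

section Sequences

/-- The natural number `n` as a von Neumann ordinal. -/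
noncomputable def nat (n : ℕ) : ZFSet.{u} := (n : Ordinal.{u}).toZFSet

theorem nat_zero : nat.{u} 0 = ∅ := by
  rw [nat, Nat.cast_zero, Ordinal.toZFSet_zero]

theorem nat_succ (n : ℕ) : nat.{u} (n + 1) = insert (nat n) (nat n) := by
  rw [nat, Nat.cast_succ, Ordinal.toZFSet_add_one, nat]

@[simp] theorem nat_mem_nat {m n : ℕ} : nat.{u} m ∈ nat n ↔ m < n := by
  simp [nat, Ordinal.toZFSet_mem_toZFSet_iff]

@[simp] theorem nat_inj {m n : ℕ} : nat.{u} m = nat n ↔ m = n := by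
  simp [nat, Ordinal.toZFSet_injective.eq_iff]

@[simp] theorem nat_subset_nat {m n : ℕ} : nat.{u} m ⊆ nat n ↔ m ≤ n := by
  simp [nat, Ordinal.toZFSet_subset_toZFSet_iff]

theorem isOrdinal_nat (n : ℕ) : (nat.{u} n).IsOrdinal := ZFSet.isOrdinal_toZFSet _

theorem mem_omega_iff {x : ZFSet.{u}} : x ∈ ZFSet.omega ↔ ∃ n, x = nat n := by
  have mk_ofNat (n : ℕ) : ZFSet.mk (PSet.ofNat n) = nat.{u} n := by
    induction n with
    | zero => rw [nat_zero]; rfl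
    | succ n ih => rw [nat_succ, ← ih]; rfl
  constructor
  · induction x using Quotient.inductionOn with
    | _ y =>
      rintro ⟨⟨n⟩, h⟩
      exact ⟨n, (ZFSet.sound h).trans (mk_ofNat n)⟩
  · rintro ⟨n, rfl⟩
    rw [← mk_ofNat]
    exact ⟨⟨n⟩, PSet.Equiv.rfl⟩

@[simp] theorem nat_mem_omega (n : ℕ) : nat.{u} n ∈ ZFSet.omega := mem_omega_iff.2 ⟨n, rfl⟩

theorem exists_mem_omega {p : ZFSet.{u} → Prop} : (∃ x ∈ ZFSet.omega, p x) ↔ ∃ n, p (nat n) := by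
  simp [mem_omega_iff]

theorem forall_mem_omega {p : ZFSet.{u} → Prop} : (∀ x ∈ ZFSet.omega, p x) ↔ ∀ n, p (nat n) := by
  simp [mem_omega_iff]

/-- The function on `ω` with values `g n`, as a set. -/
noncomputable def seq (g : ℕ → ZFSet.{u}) : ZFSet.{u} :=
  ZFSet.range fun n => ZFSet.pair (nat n) (g n)

theorem mem_seq {g : ℕ → ZFSet.{u}} {p : ZFSet.{u}} :
    p ∈ seq g ↔ ∃ n, p = ZFSet.pair (nat n) (g n) := by
  simp [seq, eq_comm]

@[simp] theorem pair_mem_seq {g : ℕ → ZFSet.{u}} {n : ℕ} {y : ZFSet.{u}} :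
    ZFSet.pair (nat n) y ∈ seq g ↔ y = g n := by
  simp only [mem_seq, ZFSet.pair_inj, nat_inj]
  exact ⟨fun ⟨_, hm, hy⟩ => hm ▸ hy, fun hy => ⟨n, rfl, hy⟩⟩

/-- The value of the function `f` at `x`. -/
noncomputable def app (f x : ZFSet.{u}) : ZFSet.{u} :=
  ((f.sUnion.sUnion).sep fun y => ZFSet.pair x y ∈ f).sUnion

theorem mem_app {f x z : ZFSet.{u}} : z ∈ app f x ↔ ∃ y, ZFSet.pair x y ∈ f ∧ z ∈ y := by
  have hsUnion {y : ZFSet.{u}} (h : ZFSet.pair x y ∈ f) : y ∈ f.sUnion.sUnion :=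
    ZFSet.mem_sUnion_of_mem (z := ({x, y} : ZFSet.{u})) (by simp)
      (ZFSet.mem_sUnion_of_mem (by simp [ZFSet.pair]) h)
  rw [app, ZFSet.mem_sUnion]
  simp only [ZFSet.mem_sep]
  exact ⟨fun ⟨y, hy, hz⟩ => ⟨y, hy.2, hz⟩, fun ⟨y, hy, hz⟩ => ⟨y, ⟨hsUnion hy, hy⟩, hz⟩⟩

@[simp] theorem app_seq (g : ℕ → ZFSet.{u}) (n : ℕ) : app (seq g) (nat n) = g n := by
  ext z
  simp [mem_app]

theorem seq_injective : Function.Injective seq.{u} := fun g g' h => by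
  ext1 n
  rw [← app_seq g, h, app_seq]

theorem isFunc_omega_iff {U f : ZFSet.{u}} :
    ZFSet.IsFunc ZFSet.omega U f ↔ ∃ g : ℕ → {x // x ∈ U}, f = seq fun n => g n := by
  constructor
  · rintro ⟨hsub, hfun⟩
    choose g hg huniq using fun n => hfun (nat n) (nat_mem_omega n)
    refine ⟨fun n => ⟨g n, (ZFSet.pair_mem_prod.1 (hsub (hg n))).2⟩, ZFSet.ext fun p => ?_⟩
    rw [mem_seq]
    constructor
    · intro hp
      obtain ⟨x, hx, y, -, rfl⟩ := ZFSet.mem_prod.1 (hsub hp)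
      obtain ⟨n, rfl⟩ := mem_omega_iff.1 hx
      exact ⟨n, by rw [huniq n y hp]⟩
    · rintro ⟨n, rfl⟩
      exact hg n
  · rintro ⟨g, rfl⟩
    refine ⟨fun p hp => ?_, forall_mem_omega.2 fun n => by simp⟩
    obtain ⟨n, rfl⟩ := mem_seq.1 hp
    exact ZFSet.pair_mem_prod.2 ⟨nat_mem_omega n, (g n).2⟩

theorem mem_omegaSeq {M : Set ZFSet.{u}} {f : ZFSet.{u}} :
    f ∈ omegaSeq M ↔ ∃ g : ℕ → M, f = seq fun n => g n := by
  constructor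
  · rintro ⟨y, hy, hf⟩
    obtain ⟨g, rfl⟩ := isFunc_omega_iff.1 hf
    exact ⟨fun n => ⟨g n, hy _ (g n).2⟩, rfl⟩
  · rintro ⟨g, rfl⟩
    exact ⟨ZFSet.range fun n => (g n : ZFSet.{u}), by simp,
      isFunc_omega_iff.2 ⟨fun n => ⟨g n, by simp⟩, rfl⟩⟩

/-- The function `x ↦ F x` on `ω`, as a set. -/
noncomputable def omegaFun (F : ZFSet.{u} → ZFSet.{u}) : ZFSet.{u} := seq fun n => F (nat n)

theorem mem_omegaFun {F : ZFSet.{u} → ZFSet.{u}} {p : ZFSet.{u}} :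
    p ∈ omegaFun F ↔ ∃ x ∈ ZFSet.omega, p = ZFSet.pair x (F x) := by
  rw [exists_mem_omega, omegaFun, mem_seq]

/-- The function `f` on `ω` with `f 0 = a` and `f (n + 1) = F n (f n)`, as a set. -/
noncomputable def recSeq (F : ZFSet.{u} → ZFSet.{u} → ZFSet.{u}) (a : ZFSet.{u}) : ZFSet.{u} :=
  seq fun n => n.rec a fun k y => F (nat k) y

@[simp] theorem app_recSeq_zero (F : ZFSet.{u} → ZFSet.{u} → ZFSet.{u}) (a : ZFSet.{u}) :
    app (recSeq F a) (nat 0) = a :=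
  app_seq _ 0

@[simp] theorem app_recSeq_succ (F : ZFSet.{u} → ZFSet.{u} → ZFSet.{u}) (a : ZFSet.{u}) (n : ℕ) :
    app (recSeq F a) (nat (n + 1)) = F (nat n) (app (recSeq F a) (nat n)) := by
  simp only [recSeq, app_seq]

theorem mem_recSeq {F : ZFSet.{u} → ZFSet.{u} → ZFSet.{u}} {a p : ZFSet.{u}} :
    p ∈ recSeq F a ↔ ∀ h : ZFSet.{u}, ZFSet.pair ∅ a ∈ h →
      (∀ x y, ZFSet.pair x y ∈ h → ZFSet.pair (insert x x) (F x y) ∈ h) → p ∈ h := by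
  constructor
  · intro hp h hzero hsucc
    obtain ⟨n, rfl⟩ := mem_seq.1 hp
    induction n with
    | zero => rwa [nat_zero]
    | succ n ih => rw [nat_succ]; exact hsucc _ _ (ih (mem_seq.2 ⟨n, rfl⟩))
  · refine fun hp => hp _ (mem_seq.2 ⟨0, congrArg (ZFSet.pair · a) nat_zero.symm⟩) fun x y hxy => ?_
    obtain ⟨n, hn⟩ := mem_seq.1 hxy
    obtain ⟨rfl, rfl⟩ := ZFSet.pair_inj.1 hn
    rw [← nat_succ, recSeq, pair_mem_seq]

end Sequences

section DefinableFunctions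

variable {B : Set ZFSet.{u}} {ι : Type} {f g : (ι → ZFSet.{u}) → ZFSet.{u}}

instance DefinableFun.sep {R : (ι → ZFSet.{u}) → ZFSet.{u} → Prop} [hf : DefinableFun B f]
    [DefinablePred B fun w : Option ι → ZFSet.{u} => R (fun i => w (some i)) (w none)] :
    DefinableFun B fun v => (f v).sep (R v) :=
  have := hf.comp (κ := Option ι) some
  .of_mem_iff (R := fun x v => x ∈ f v ∧ R v x) fun _ _ => ZFSet.mem_sep

instance DefinableFun.omega : DefinableFun B fun _ : ι → ZFSet.{u} => ZFSet.omega := by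
  refine .of_mem_iff (R := fun x _ => ∀ h, ∅ ∈ h → (∀ k, k ∈ h → Insert.insert k k ∈ h) → x ∈ h)
    fun _ x => ⟨fun hx h hzero hsucc => ?_,
      fun h => h _ ZFSet.omega_zero fun _ => ZFSet.omega_succ⟩
  obtain ⟨n, rfl⟩ := mem_omega_iff.1 hx
  induction n with
  | zero => rwa [nat_zero]
  | succ n ih => rw [nat_succ]; exact hsucc _ (ih (nat_mem_omega n))

instance DefinableFun.nat (n : ℕ) : DefinableFun B fun _ : ι → ZFSet.{u} => nat n := by
  induction n with
  | zero => rw [nat_zero]; infer_instance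
  | succ n _ => rw [nat_succ]; infer_instance

instance DefinableFun.app [hf : DefinableFun B f] [hg : DefinableFun B g] :
    DefinableFun B fun v => app (f v) (g v) :=
  .subst₂ (F := HODModels.app) (.of_mem_iff
    (R := fun z v => ∃ y, ZFSet.pair (v 1) y ∈ v 0 ∧ z ∈ y) fun _ _ => mem_app) hf hg

instance DefinableFun.omegaFun {F : (ι → ZFSet.{u}) → ZFSet.{u} → ZFSet.{u}}
    [h : DefinableFun B fun w : Option ι → ZFSet.{u} => F (fun i => w (some i)) (w none)] :
    DefinableFun B fun v => omegaFun (F v) :=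
  have : DefinableFun B fun w : Option (Option ι) → ZFSet.{u} =>
      F (fun i => w (some (some i))) (w none) :=
    h.comp fun o => o.elim none fun i => some (some i)
  .of_mem_iff (R := fun z v => ∃ x, x ∈ ZFSet.omega ∧ z = ZFSet.pair x (F v x))
    fun _ _ => mem_omegaFun

instance DefinableFun.recSeq {F : (ι → ZFSet.{u}) → ZFSet.{u} → ZFSet.{u} → ZFSet.{u}}
    [h : DefinableFun B fun w : Option (Option ι) → ZFSet.{u} =>
      F (fun i => w (some (some i))) (w (some none)) (w none)] [hf : DefinableFun B f] :
    DefinableFun B fun v => recSeq (F v) (f v) :=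
  have := hf.comp (κ := Option (Option ι)) fun i => some (some i)
  have : DefinableFun B fun w : Option (Option (Option (Option ι))) → ZFSet.{u} =>
      F (fun i => w (some (some (some (some i))))) (w (some none)) (w none) :=
    h.comp fun o => o.elim none fun o => some (o.elim none fun i => some (some (some i)))
  .of_mem_iff (R := fun p v => ∀ h, ZFSet.pair ∅ (f v) ∈ h →
    (∀ x y, ZFSet.pair x y ∈ h → ZFSet.pair (Insert.insert x x) (F v x y) ∈ h) → p ∈ h)
    fun _ _ => mem_recSeq

end DefinableFunctions

section Arithmetic

/-- Addition of natural numbers, by recursion on `y`. -/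
noncomputable def add (x y : ZFSet.{u}) : ZFSet.{u} := app (recSeq (fun _ z => insert z z) x) y

/-- Multiplication of natural numbers, by recursion on `y`. -/
noncomputable def mul (x y : ZFSet.{u}) : ZFSet.{u} := app (recSeq (fun _ z => add z x) ∅) y

open Classical in
/-- The pairing function `Nat.pair` on natural numbers as sets. -/
noncomputable def natPair (x y : ZFSet.{u}) : ZFSet.{u} :=
  if x ∈ y then add (mul y y) x else add (add (mul x x) x) y

theorem add_nat (m n : ℕ) : add (nat.{u} m) (nat n) = nat (m + n) := by
  induction n with
  | zero => exact app_recSeq_zero _ _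
  | succ n ih => rw [add, app_recSeq_succ, ← add, ih, ← nat_succ, Nat.add_assoc]

theorem mul_nat (m n : ℕ) : mul (nat.{u} m) (nat n) = nat (m * n) := by
  induction n with
  | zero => rw [mul, app_recSeq_zero, Nat.mul_zero, nat_zero]
  | succ n ih => rw [mul, app_recSeq_succ, ← mul, ih, add_nat, Nat.mul_succ]

@[simp] theorem natPair_nat (m n : ℕ) : natPair (nat.{u} m) (nat n) = nat (Nat.pair m n) := by
  simp only [natPair, nat_mem_nat, mul_nat, add_nat, Nat.pair, apply_ite nat]

variable {B : Set ZFSet.{u}} {ι : Type} {f g : (ι → ZFSet.{u}) → ZFSet.{u}}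

instance DefinableFun.add [hf : DefinableFun B f] [hg : DefinableFun B g] :
    DefinableFun B fun v => add (f v) (g v) :=
  .subst₂ (F := HODModels.add) (by unfold HODModels.add; infer_instance) hf hg

instance DefinableFun.mul [hf : DefinableFun B f] [hg : DefinableFun B g] :
    DefinableFun B fun v => mul (f v) (g v) :=
  .subst₂ (F := HODModels.mul) (by unfold HODModels.mul; infer_instance) hf hg

instance DefinableFun.natPair [DefinableFun B f] [DefinableFun B g] :
    DefinableFun B fun v => natPair (f v) (g v) := by
  unfold HODModels.natPair
  infer_instance

end Arithmetic

section Codes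

/-- A formula of the language of set theory with variables indexed by natural numbers. -/
inductive Code : Type
  | eq (i j : ℕ)
  | mem (i j : ℕ)
  | imp (φ ψ : Code)
  | all (i : ℕ) (φ : Code)

namespace Code

/-- The Gödel number of a formula. -/
def encode : Code → ℕ
  | eq i j => Nat.pair 0 (Nat.pair i j)
  | mem i j => Nat.pair 1 (Nat.pair i j)
  | imp φ ψ => Nat.pair 2 (Nat.pair φ.encode ψ.encode)
  | all i φ => Nat.pair (i + 3) φ.encode

theorem encode_injective : Function.Injective encode := by
  intro φ
  induction φ with
  | eq i j | mem i j => rintro (_ | _ | _ | _) h <;> simp_all [encode, Nat.pair_eq_pair]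
  | imp φ ψ ihφ ihψ =>
    rintro (_ | _ | _ | _) h <;> simp only [encode, Nat.pair_eq_pair] at h
    · omega
    · omega
    · rw [ihφ h.2.1, ihψ h.2.2]
    · omega
  | all i φ ih =>
    rintro (_ | _ | _ | _) h <;> simp only [encode, Nat.pair_eq_pair] at h
    · omega
    · omega
    · omega
    · rw [ih h.2, Nat.add_right_cancel h.1]

theorem encode_surjective : Function.Surjective encode := by
  intro n
  induction n using Nat.strong_induction_on with
  | _ n ih =>
    obtain ⟨a, m, rfl⟩ : ∃ a m, n = Nat.pair a m := ⟨_, _, (Nat.pair_unpair n).symm⟩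
    obtain ⟨i, j, rfl⟩ : ∃ i j, m = Nat.pair i j := ⟨_, _, (Nat.pair_unpair m).symm⟩
    have hij := Nat.add_le_pair i j
    match a with
    | 0 => exact ⟨eq i j, rfl⟩
    | 1 => exact ⟨mem i j, rfl⟩
    | 2 =>
      have := Nat.add_le_pair 2 (Nat.pair i j)
      obtain ⟨φ, rfl⟩ := ih i (by omega)
      obtain ⟨ψ, rfl⟩ := ih j (by omega)
      exact ⟨imp φ ψ, rfl⟩
    | k + 3 =>
      have := Nat.add_le_pair (k + 3) (Nat.pair i j)
      obtain ⟨φ, hφ⟩ := ih (Nat.pair i j) (by omega)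
      exact ⟨all k φ, by rw [encode, hφ]⟩

variable {N : Type*} (E : N → N → Prop)

/-- The formula holds in `(N, E)` under an assignment of values to the variables. -/
def Realize : Code → (ℕ → N) → Prop
  | eq i j, g => g i = g j
  | mem i j, g => E (g i) (g j)
  | imp φ ψ, g => φ.Realize g → ψ.Realize g
  | all i φ, g => ∀ x, φ.Realize (Function.update g i x)

end Code

variable {N : Type*} {E : N → N → Prop}

theorem exists_var_of_term {m k : ℕ} (t : memLang.Term (Fin m ⊕ Fin k)) :
    ∃ i : ℕ, letI := memStructure E
      ∀ g : ℕ → N,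
        t.realize (Sum.elim (fun i : Fin m => g i) fun j : Fin k => g (m + j)) = g i := by
  rcases t with (i | j) | ⟨f, -⟩
  · exact ⟨i, fun _ => rfl⟩
  · exact ⟨m + j, fun _ => rfl⟩
  · exact f.elim

theorem snoc_update {m k : ℕ} (g : ℕ → N) (x : N) :
    (fun j : Fin (k + 1) => Function.update g (m + k) x (m + j)) =
      Fin.snoc (α := fun _ => N) (fun j : Fin k => g (m + j)) x := by
  ext j
  refine Fin.lastCases ?_ (fun j => ?_) j
  · simp
  · simp [Function.update_of_ne, j.2.ne]

theorem Code.exists_realize_iff (hE : ∀ x, ¬ E x x) {m k : ℕ}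
    (φ : memLang.BoundedFormula (Fin m) k) :
    ∃ c : Code, letI := memStructure E
      ∀ g : ℕ → N, c.Realize E g ↔ φ.Realize (fun i => g i) fun j => g (m + j) := by
  let _ := memStructure E
  induction φ with
  | falsum => exact ⟨.mem 0 0, fun g => iff_false_intro (hE (g 0))⟩
  | equal t₁ t₂ =>
    obtain ⟨i, hi⟩ := exists_var_of_term (E := E) t₁
    obtain ⟨j, hj⟩ := exists_var_of_term (E := E) t₂
    exact ⟨.eq i j, fun g => by
      simp only [Code.Realize, Language.BoundedFormula.Realize, hi, hj]⟩
  | rel R ts =>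
    cases R
    obtain ⟨i, hi⟩ := exists_var_of_term (E := E) (ts 0)
    obtain ⟨j, hj⟩ := exists_var_of_term (E := E) (ts 1)
    exact ⟨.mem i j, fun g => by
      simp only [Code.Realize, Language.BoundedFormula.Realize, Language.Structure.RelMap, hi, hj]⟩
  | imp φ ψ ihφ ihψ =>
    obtain ⟨c, hc⟩ := ihφ
    obtain ⟨d, hd⟩ := ihψ
    exact ⟨.imp c d, fun g => imp_congr (hc g) (hd g)⟩
  | @all k φ ih =>
    obtain ⟨c, hc⟩ := ih
    refine ⟨.all (m + k) c, fun g => forall_congr' fun x => (hc _).trans ?_⟩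
    rw [snoc_update]
    refine iff_of_eq (congrArg (fun v => φ.Realize v _) (funext fun i => ?_))
    exact Function.update_of_ne (by omega) _ _

end Codes

section Reflection

/-- The membership relation restricted to a set `U`. -/
def memIn (U : ZFSet.{u}) : {x // x ∈ U} → {x // x ∈ U} → Prop :=
  fun x y => (x : ZFSet.{u}) ∈ (y : ZFSet.{u})

/-- The elements of a set, as a structure for the language of set theory. -/
instance setStructure (U : ZFSet.{u}) : memLang.Structure {x // x ∈ U} := memStructure (memIn U)

/-- The inclusion of a set in the universe. -/
def inclusion (U : ZFSet.{u}) : {x // x ∈ U} ↪[memLang] ZFSet.{u} where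
  toFun := Subtype.val
  inj' := Subtype.val_injective
  map_fun' f := f.elim
  map_rel' := by rintro _ ⟨⟩ v; rfl

open ZFSet

theorem exists_vonNeumann_witnesses {α : Type} (v : α → ZFSet.{u}) (a : Ordinal.{u}) :
    ∃ b, a ≤ b ∧
      ∀ (n : ℕ) (φ : memLang.BoundedFormula α (n + 1)) (x : Fin n → ZFSet.{u}),
        (∀ i, x i ∈ V_ a) → ∀ y : ZFSet.{u}, φ.Realize v (Fin.snoc x y : _ → ZFSet.{u}) →
        ∃ z ∈ V_ b, φ.Realize v (Fin.snoc x z : _ → ZFSet.{u}) := by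
  let I := Σ n, memLang.BoundedFormula α (n + 1) × (Fin n → {x // x ∈ V_ a})
  let Witness (i : I) (y : ZFSet.{u}) : Prop :=
    i.2.1.Realize v (Fin.snoc (fun k => (i.2.2 k : ZFSet.{u})) y : _ → ZFSet.{u})
  let W (i : I) : ZFSet.{u} := Classical.epsilon (Witness i)
  refine ⟨max a (⨆ i, Order.succ (rank (W i))), le_max_left _ _, fun n φ x hx y hy => ?_⟩
  let i : I := ⟨n, φ, fun k => ⟨x k, hx k⟩⟩
  refine ⟨W i, mem_vonNeumann.2 ?_, Classical.epsilon_spec (p := Witness i) ⟨y, hy⟩⟩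
  exact (Order.lt_succ _).trans_le ((Ordinal.le_iSup _ i).trans (le_max_right _ _))

theorem exists_vonNeumann_elementaryEmbedding (t : ZFSet.{u}) :
    ∃ o : Ordinal.{u}, t ∈ V_ o ∧
      ∃ f : {x // x ∈ V_ o} ↪ₑ[memLang] ZFSet.{u}, ∀ x, f x = x := by
  choose F hF hwitness using exists_vonNeumann_witnesses (α := Empty) isEmptyElim
  let a (k : ℕ) := F^[k] (Order.succ (rank t))
  have ha_succ (k : ℕ) : a (k + 1) = F (a k) := Function.iterate_succ_apply' _ _ _
  have ha : Monotone a := monotone_nat_of_le_succ fun k => (hF (a k)).trans_eq (ha_succ k).symm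
  have mem_iff {x : ZFSet.{u}} : x ∈ V_ (⨆ k, a k) ↔ ∃ k, x ∈ V_ (a k) := by
    simp only [mem_vonNeumann, Ordinal.lt_iSup_iff]
  refine ⟨⨆ k, a k, mem_iff.2 ⟨0, mem_vonNeumann.2 (Order.lt_succ _)⟩,
    (inclusion _).toElementaryEmbedding fun n φ x y hy => ?_, fun _ => rfl⟩
  choose k hk using fun i => mem_iff.1 (x i).2
  obtain ⟨l, hl⟩ := Finite.bddAbove_range k
  have hx (i : Fin n) : (x i : ZFSet.{u}) ∈ V_ (a l) :=
    vonNeumann_subset_of_le (ha (hl ⟨i, rfl⟩)) (hk i)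
  obtain ⟨z, hz, hφ⟩ := hwitness (a l) n φ _ hx y hy
  exact ⟨⟨z, mem_iff.2 ⟨l + 1, ha_succ l ▸ hz⟩⟩, hφ⟩

end Reflection

section Levels

open ZFSet

/-- `U` is a level of the cumulative hierarchy. -/
def IsLevel (U : ZFSet.{u}) : Prop := ∃ o : Ordinal.{u}, U = V_ o

theorem isLevel_vonNeumann (o : Ordinal.{u}) : IsLevel (V_ o) := ⟨o, rfl⟩

theorem eq_vonNeumann_rank_of_forall_mem_iff {W h : ZFSet.{u}}
    (hh : ∀ U ∈ h, U ∈ W → U = V_ (rank U))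
    (hW : ∀ x, x ∈ W ↔ ∃ U ∈ h, U ∈ W ∧ x ⊆ U) : W = V_ (rank W) := by
  refine ZFSet.ext fun x => (hW x).trans ?_
  rw [mem_vonNeumann']
  constructor
  · rintro ⟨U, hUh, hUW, hxU⟩
    exact ⟨rank U, rank_lt_of_mem hUW, hh U hUh hUW ▸ hxU⟩
  · rintro ⟨a, ha, hxa⟩
    obtain ⟨y, hyW, hay⟩ := lt_rank_iff.1 ha
    obtain ⟨U, hUh, hUW, hyU⟩ := (hW y).1 hyW
    refine ⟨U, hUh, hUW, hxa.trans ?_⟩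
    rw [hh U hUh hUW]
    exact vonNeumann_subset_of_le (hay.trans (rank_mono hyU))

/-- The set `h` of all levels up to `U` witnesses that `U` is a level: this is the history of `U` in
the sense of Scott and Derrick. -/
theorem isLevel_iff {U : ZFSet.{u}} : IsLevel U ↔
    ∃ h : ZFSet.{u}, U ∈ h ∧ ∀ W ∈ h, ∀ x, x ∈ W ↔ ∃ W' ∈ h, W' ∈ W ∧ x ⊆ W' := by
  constructor
  · rintro ⟨o, rfl⟩
    have mem_h {W : ZFSet.{u}} :
        W ∈ (V_ (Order.succ o)).sep IsLevel ↔ ∃ a ≤ o, W = V_ a := by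
      rw [mem_sep]
      refine ⟨?_, ?_⟩
      · rintro ⟨hW, a, rfl⟩
        exact ⟨a, Order.lt_succ_iff.1 (vonNeumann_mem_vonNeumann_iff.1 hW), rfl⟩
      · rintro ⟨a, ha, rfl⟩
        exact ⟨vonNeumann_mem_vonNeumann_iff.2 (Order.lt_succ_iff.2 ha), isLevel_vonNeumann a⟩
    refine ⟨_, mem_h.2 ⟨o, le_rfl, rfl⟩, fun W hW x => ?_⟩
    obtain ⟨a, ha, rfl⟩ := mem_h.1 hW
    rw [mem_vonNeumann']
    constructor
    · rintro ⟨b, hb, hx⟩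
      exact ⟨V_ b, mem_h.2 ⟨b, hb.le.trans ha, rfl⟩, vonNeumann_mem_vonNeumann_iff.2 hb, hx⟩
    · rintro ⟨W', hW', hW'a, hx⟩
      obtain ⟨b, -, rfl⟩ := mem_h.1 hW'
      exact ⟨b, vonNeumann_mem_vonNeumann_iff.1 hW'a, hx⟩
  · rintro ⟨h, hU, hh⟩
    have hlevel (W : ZFSet.{u}) : W ∈ h → W = V_ (rank W) := by
      induction W using inductionOn with
      | _ W ih =>
        exact fun hW => eq_vonNeumann_rank_of_forall_mem_iff
          (fun W' hW' hW'W => ih W' hW'W hW') (hh W hW)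
    exact ⟨rank U, hlevel U hU⟩

instance DefinablePred.isLevel {B : Set ZFSet.{u}} {ι : Type} {f : (ι → ZFSet.{u}) → ZFSet.{u}}
    [hf : DefinableFun B f] : DefinablePred B fun v => IsLevel (f v) :=
  .subst₁ (Q := IsLevel) ((inferInstance : DefinablePred B fun v : Fin 1 → ZFSet.{u} =>
    ∃ h : ZFSet.{u}, v 0 ∈ h ∧ ∀ W, W ∈ h →
      ∀ x : ZFSet.{u}, x ∈ W ↔ ∃ W' : ZFSet.{u}, W' ∈ h ∧ W' ∈ W ∧ x ⊆ W').congr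
        fun _ => isLevel_iff.symm) hf

end Levels

section Satisfaction

variable {B : Set ZFSet.{u}} {ι : Type} {f g h : (ι → ZFSet.{u}) → ZFSet.{u}}
  {U R n σ : ZFSet.{u}}

/-- `σ` is an assignment in `U`: a function from `ω` to `U`, as a set. -/
def IsAssignment (U σ : ZFSet.{u}) : Prop :=
  σ = omegaFun (app σ) ∧ ∀ i ∈ ZFSet.omega, app σ i ∈ U

instance DefinablePred.isAssignment [DefinableFun B f] [DefinableFun B g] :
    DefinablePred B fun v => IsAssignment (f v) (g v) :=
  .subst₂ (Q := IsAssignment) (by unfold IsAssignment; infer_instance) ‹_› ‹_›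

theorem isAssignment_iff :
    IsAssignment U σ ↔ ∃ g : ℕ → {x // x ∈ U}, σ = seq fun n => g n := by
  rw [IsAssignment, forall_mem_omega]
  constructor
  · exact fun ⟨hσ, hU⟩ => ⟨fun n => ⟨app σ (nat n), hU n⟩, hσ⟩
  · rintro ⟨g, rfl⟩
    simp [omegaFun]

open Classical in
/-- The assignment `σ`, with the value of the variable `i` changed to `x`. -/
noncomputable def update (σ i x : ZFSet.{u}) : ZFSet.{u} :=
  omegaFun fun j => if j = i then x else app σ j

theorem update_seq (g : ℕ → {x // x ∈ U}) (i : ℕ) (x : {x // x ∈ U}) :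
    update (seq fun n => g n) (nat i) x = seq fun n => Function.update g i x n := by
  refine congrArg seq (funext fun n => ?_)
  by_cases hn : n = i <;> simp [hn]

/-- The formula with Gödel number `n` holds in `(U, ∈)` under the assignment `σ`. -/
def SatIn (U n σ : ZFSet.{u}) : Prop :=
  ∃ (φ : Code) (g : ℕ → {x // x ∈ U}), n = nat φ.encode ∧ (σ = seq fun n => g n) ∧
    φ.Realize (memIn U) g

theorem satIn_nat_seq {φ : Code} {g : ℕ → {x // x ∈ U}} :
    SatIn U (nat φ.encode) (seq fun n => g n) ↔ φ.Realize (memIn U) g := by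
  refine ⟨?_, fun h => ⟨φ, g, rfl, rfl, h⟩⟩
  rintro ⟨φ', g', hφ, hg, h⟩
  obtain rfl := Code.encode_injective (nat_inj.1 hφ)
  obtain rfl : g = g' := funext fun n => Subtype.ext (congrFun (seq_injective hg) n)
  exact h

/-- The set `R` of pairs of a Gödel number and an assignment obeys Tarski's truth conditions
in `(U, ∈)`. -/
def IsSatTable (U R : ZFSet.{u}) : Prop :=
  ∀ σ, IsAssignment U σ → ∀ i ∈ ZFSet.omega, ∀ j ∈ ZFSet.omega,
    (ZFSet.pair (natPair (nat 0) (natPair i j)) σ ∈ R ↔ app σ i = app σ j) ∧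
    (ZFSet.pair (natPair (nat 1) (natPair i j)) σ ∈ R ↔ app σ i ∈ app σ j) ∧
    (ZFSet.pair (natPair (nat 2) (natPair i j)) σ ∈ R ↔
      (ZFSet.pair i σ ∈ R → ZFSet.pair j σ ∈ R)) ∧
    (ZFSet.pair (natPair (add i (nat 3)) j) σ ∈ R ↔
      ∀ x ∈ U, ZFSet.pair j (update σ i x) ∈ R)

theorem isSatTable_iff : IsSatTable U R ↔ ∀ (g : ℕ → {x // x ∈ U}) (i j : ℕ),
    (ZFSet.pair (nat (Nat.pair 0 (Nat.pair i j))) (seq fun n => g n) ∈ R ↔ g i = g j) ∧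
    (ZFSet.pair (nat (Nat.pair 1 (Nat.pair i j))) (seq fun n => g n) ∈ R ↔
      (g i : ZFSet.{u}) ∈ (g j : ZFSet.{u})) ∧
    (ZFSet.pair (nat (Nat.pair 2 (Nat.pair i j))) (seq fun n => g n) ∈ R ↔
      (ZFSet.pair (nat i) (seq fun n => g n) ∈ R →
        ZFSet.pair (nat j) (seq fun n => g n) ∈ R)) ∧
    (ZFSet.pair (nat (Nat.pair (i + 3) j)) (seq fun n => g n) ∈ R ↔
      ∀ x : {x // x ∈ U}, ZFSet.pair (nat j) (seq fun n => Function.update g i x n) ∈ R) := by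
  simp only [IsSatTable, isAssignment_iff, forall_exists_index, forall_eq_apply_imp_iff,
    forall_mem_omega, natPair_nat, add_nat, app_seq, Subtype.ext_iff, ← update_seq,
    Subtype.forall]

theorem IsSatTable.pair_mem_iff (hR : IsSatTable U R) (φ : Code) (g : ℕ → {x // x ∈ U}) :
    ZFSet.pair (nat φ.encode) (seq fun n => g n) ∈ R ↔ φ.Realize (memIn U) g := by
  rw [isSatTable_iff] at hR
  induction φ generalizing g with
  | eq i j => exact (hR g i j).1
  | mem i j => exact (hR g i j).2.1
  | imp φ ψ ihφ ihψ => exact (hR g _ _).2.2.1.trans (imp_congr (ihφ g) (ihψ g))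
  | all i φ ih => exact (hR g _ _).2.2.2.trans (forall_congr' fun x => ih _)

theorem exists_isSatTable (U : ZFSet.{u}) : ∃ R, IsSatTable U R := by
  let R := ZFSet.range fun p : {p : Code × (ℕ → {x // x ∈ U}) // p.1.Realize (memIn U) p.2} =>
    ZFSet.pair (nat p.1.1.encode) (seq fun n => p.1.2 n)
  have hR {m : ℕ} {g : ℕ → {x // x ∈ U}} (φ : Code) (hm : m = φ.encode) :
      ZFSet.pair (nat m) (seq fun n => g n) ∈ R ↔ φ.Realize (memIn U) g := by
    rw [← satIn_nat_seq, SatIn, hm, ZFSet.mem_range]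
    simp [ZFSet.pair_inj, eq_comm, and_comm, and_left_comm]
  refine ⟨R, isSatTable_iff.2 fun g i j => ?_⟩
  obtain ⟨φ, rfl⟩ := Code.encode_surjective i
  obtain ⟨ψ, rfl⟩ := Code.encode_surjective j
  refine ⟨hR (.eq _ _) rfl, hR (.mem _ _) rfl, ?_, ?_⟩
  · exact (hR (.imp φ ψ) rfl).trans (imp_congr (hR φ rfl) (hR ψ rfl)).symm
  · exact (hR (.all _ ψ) rfl).trans (forall_congr' fun x => hR ψ rfl).symm

theorem satIn_iff : SatIn U n σ ↔ n ∈ ZFSet.omega ∧ IsAssignment U σ ∧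
    ∃ R, IsSatTable U R ∧ ZFSet.pair n σ ∈ R := by
  constructor
  · rintro ⟨φ, g, rfl, rfl, hφ⟩
    obtain ⟨R, hR⟩ := exists_isSatTable U
    exact ⟨nat_mem_omega _, isAssignment_iff.2 ⟨g, rfl⟩, R, hR, (hR.pair_mem_iff φ g).2 hφ⟩
  · rintro ⟨hn, hσ, R, hR, hnσ⟩
    obtain ⟨m, rfl⟩ := mem_omega_iff.1 hn
    obtain ⟨φ, rfl⟩ := Code.encode_surjective m
    obtain ⟨g, rfl⟩ := isAssignment_iff.1 hσ
    exact satIn_nat_seq.2 ((hR.pair_mem_iff φ g).1 hnσ)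

instance DefinableFun.update [hf : DefinableFun B f] [hg : DefinableFun B g]
    [hh : DefinableFun B h] : DefinableFun B fun v => update (f v) (g v) (h v) := by
  have := hf.comp (κ := Option ι) some
  have := hg.comp (κ := Option ι) some
  have := hh.comp (κ := Option ι) some
  unfold HODModels.update
  infer_instance

instance DefinablePred.isSatTable [DefinableFun B f] [DefinableFun B g] :
    DefinablePred B fun v => IsSatTable (f v) (g v) :=
  .subst₂ (Q := IsSatTable) (by unfold IsSatTable; infer_instance) ‹_› ‹_›

instance DefinablePred.satIn [DefinableFun B f] [DefinableFun B g] [DefinableFun B h] :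
    DefinablePred B fun v => SatIn (f v) (g v) (h v) :=
  .subst₃ (Q := SatIn) (.congr (P := fun v => v 1 ∈ ZFSet.omega ∧ IsAssignment (v 0) (v 2) ∧
    ∃ R, IsSatTable (v 0) R ∧ ZFSet.pair (v 1) (v 2) ∈ R) inferInstance
    fun _ => satIn_iff.symm) ‹_› ‹_› ‹_›

end Satisfaction

section Choice

open ZFSet

variable {B : Set ZFSet.{u}} {ι : Type} {f g h k : (ι → ZFSet.{u}) → ZFSet.{u}}
  {U n t x y Z : ZFSet.{u}}

/-- `U` is a level of the cumulative hierarchy, and `x` is the only set that satisfies in `(U, ∈)`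
the formula with Gödel number `n`, with `t` as the value of the second variable. -/
def DefinedBy (U n t x : ZFSet.{u}) : Prop :=
  IsLevel U ∧ n ∈ ZFSet.omega ∧
    ∀ y, (∃ σ, SatIn U n σ ∧ app σ (nat 0) = y ∧ app σ (nat 1) = t) ↔ y = x

theorem DefinedBy.unique (hx : DefinedBy U n t x) (hy : DefinedBy U n t y) : x = y :=
  (hy.2.2 x).1 ((hx.2.2 x).2 rfl)

instance DefinablePred.definedBy [DefinableFun B f] [DefinableFun B g] [DefinableFun B h]
    [DefinableFun B k] : DefinablePred B fun v => DefinedBy (f v) (g v) (h v) (k v) :=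
  .subst₄ (Q := DefinedBy) (by unfold DefinedBy; infer_instance) ‹_› ‹_› ‹_› ‹_›

theorem exists_formula_of_mem_dcl_singleton (hx : x ∈ dcl {t}) :
    ∃ φ : memLang.Formula (Fin 2), ∀ y, φ.Realize ![y, t] ↔ y = x := by
  obtain ⟨φ, hφ⟩ := Set.definable_iff_exists_formula_sum.1 hx
  refine ⟨φ.relabel (Sum.elim (fun _ => 1) fun _ => 0), fun y =>
    Language.Formula.realize_relabel.trans (Iff.trans (iff_of_eq (congrArg φ.Realize ?_))
      (Set.ext_iff.1 hφ fun _ => y).symm)⟩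
  exact funext (Sum.rec (fun b => b.2.symm) fun _ => rfl)

theorem exists_definedBy_of_mem_dcl_singleton (hx : x ∈ dcl {t}) :
    ∃ U n, DefinedBy U n t x := by
  obtain ⟨φ, hφ⟩ := exists_formula_of_mem_dcl_singleton hx
  obtain ⟨o, ho, f, hf⟩ := exists_vonNeumann_elementaryEmbedding {x, t}
  have htrans := (isTransitive_vonNeumann o).subset_of_mem ho
  obtain ⟨c, hc⟩ := Code.exists_realize_iff (E := memIn (V_ o)) (fun y => mem_irrefl y.1) φ
  have hcx (g : ℕ → {y // y ∈ V_ o}) (hg : (g 1 : ZFSet.{u}) = t) :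
      c.Realize (memIn (V_ o)) g ↔ (g 0 : ZFSet.{u}) = x := by
    rw [← hφ, hc, ← hg]
    refine Iff.trans ?_ ((f.map_formula φ fun i : Fin 2 => g i).symm.trans ?_)
    · exact iff_of_eq (congrArg _ (Subsingleton.elim _ _))
    · exact iff_of_eq (congrArg φ.Realize (funext (Fin.forall_fin_two.2 ⟨hf _, hf _⟩)))
  refine ⟨V_ o, nat c.encode, isLevel_vonNeumann o, nat_mem_omega _, fun y => ⟨?_, ?_⟩⟩
  · rintro ⟨_, ⟨c', g, hc', rfl, hg⟩, rfl, ht⟩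
    obtain rfl := Code.encode_injective (nat_inj.1 hc')
    rw [app_seq] at ht ⊢
    exact (hcx g ht).1 hg
  · rintro rfl
    let g (i : ℕ) : {z // z ∈ V_ o} :=
      if i = 0 then ⟨y, htrans (by simp)⟩ else ⟨t, htrans (by simp)⟩
    exact ⟨_, satIn_nat_seq.2 ((hcx g rfl).2 rfl), app_seq _ 0, app_seq _ 1⟩

theorem exists_definedBy_of_mem_OD_singleton (hx : x ∈ OD {t}) : ∃ U n, DefinedBy U n t x := by
  have ht {ι : Type} : DefinableFun {t} fun _ : ι → ZFSet.{u} => t := .const rfl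
  exact dcl_ordinals_union_subset (C := {x | ∃ U n, DefinedBy U n t x})
    (inferInstance : DefinablePred {t} fun v : Fin 1 → ZFSet.{u} => ∃ U n, DefinedBy U n t (v 0))
    (fun _ => exists_definedBy_of_mem_dcl_singleton) hx

/-- `x` is the element of `Z` with the least definition from `t` in a level of the cumulative
hierarchy, where definitions are compared by level and then by Gödel number. -/
def IsChosen (Z t x : ZFSet.{u}) : Prop :=
  x ∈ Z ∧ ∃ U n, DefinedBy U n t x ∧
    ∀ y ∈ Z, ∀ U' n', DefinedBy U' n' t y → U ∈ U' ∨ U = U' ∧ n ⊆ n'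

theorem IsChosen.unique (hx : IsChosen Z t x) (hy : IsChosen Z t y) : x = y := by
  obtain ⟨hxZ, U, n, hUx, hUmin⟩ := hx
  obtain ⟨hyZ, U', n', hUy, hUmin'⟩ := hy
  rcases hUmin y hyZ U' n' hUy with h | ⟨rfl, h⟩ <;>
    rcases hUmin' x hxZ U n hUx with h' | ⟨hU, h'⟩
  · exact absurd h' (mem_asymm h)
  · exact absurd (hU ▸ h) (mem_irrefl _)
  · exact absurd h' (mem_irrefl _)
  · exact hUx.unique (h.antisymm h' ▸ hUy)

theorem exists_isChosen (h : ∃ x ∈ Z, x ∈ OD {t}) : ∃ x, IsChosen Z t x := by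
  let S : Set (Ordinal.{u} ×ₗ ℕ) :=
    {p | ∃ x ∈ Z, DefinedBy (V_ (ofLex p).1) (nat (ofLex p).2) t x}
  have mem_S {U n x : ZFSet.{u}} (hx : x ∈ Z) (h : DefinedBy U n t x) :
      ∃ p ∈ S, U = V_ (ofLex p).1 ∧ n = nat (ofLex p).2 := by
    obtain ⟨o, rfl⟩ := h.1
    obtain ⟨m, rfl⟩ := mem_omega_iff.1 h.2.1
    exact ⟨toLex (o, m), ⟨x, hx, h⟩, rfl, rfl⟩
  obtain ⟨x, hxZ, hx⟩ := h
  obtain ⟨U, n, hUn⟩ := exists_definedBy_of_mem_OD_singleton hx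
  obtain ⟨p, ⟨y, hyZ, hy⟩, hmin⟩ := wellFounded_lt.has_min S ((mem_S hxZ hUn).imp fun _ h => h.1)
  refine ⟨y, hyZ, _, _, hy, fun z hz U' n' hz' => ?_⟩
  obtain ⟨q, hq, rfl, rfl⟩ := mem_S hz hz'
  rw [vonNeumann_mem_vonNeumann_iff, vonNeumann_inj, nat_subset_nat]
  exact Prod.Lex.le_iff.1 (not_lt.1 (hmin q hq))

/-- The element of `Z` with the least definition from `t` in a level of the cumulative hierarchy, if
there is one. It is obtained as the union of the set of all such elements. -/
noncomputable def chosen (Z t : ZFSet.{u}) : ZFSet.{u} := (Z.sep (IsChosen Z t)).sUnion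

theorem chosen_mem (h : ∃ x ∈ Z, x ∈ OD {t}) : chosen Z t ∈ Z := by
  obtain ⟨x, hx⟩ := exists_isChosen h
  have hsep : Z.sep (IsChosen Z t) = {x} := by
    ext y
    rw [mem_sep, mem_singleton]
    exact ⟨fun hy => hy.2.unique hx, by rintro rfl; exact ⟨hx.1, hx⟩⟩
  rw [chosen, hsep, sUnion_singleton]
  exact hx.1

instance DefinableFun.chosen [DefinableFun B f] [DefinableFun B g] :
    DefinableFun B fun v => chosen (f v) (g v) :=
  .subst₂ (F := HODModels.chosen) (.of_mem_iff
    (R := fun x v => ∃ y, (y ∈ v 0 ∧ y ∈ v 0 ∧ ∃ U n, DefinedBy U n (v 1) y ∧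
      ∀ z, z ∈ v 0 → ∀ U' n', DefinedBy U' n' (v 1) z → U ∈ U' ∨ U = U' ∧ n ⊆ n') ∧ x ∈ y)
    fun _ _ => by simp only [HODModels.chosen, IsChosen, mem_sUnion, mem_sep]) ‹_› ‹_›

end Choice

section Sequences

variable {X : Set ZFSet.{u}} {x : ZFSet.{u}}

/-- Every sequence of elements of `X` is definable from a single element of `X`. -/
def CodesSequences (X : Set ZFSet.{u}) : Prop :=
  ∀ s : ℕ → X, ∃ t ∈ X, seq (fun n => s n) ∈ dcl {t}

theorem codesSequences_omegaSeq (M : Set ZFSet.{u}) : CodesSequences (omegaSeq M) := by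
  intro s
  choose F hF using fun n => mem_omegaSeq.1 (s n).2
  let t : ZFSet.{u} := seq fun k => F k.unpair.1 k.unpair.2
  have hst : seq (fun n => s n) = omegaFun fun x => omegaFun fun y => app t (natPair x y) := by
    simp only [omegaFun, t, natPair_nat, app_seq, Nat.unpair_pair, hF]
  have ht {ι : Type} : DefinableFun {t} fun _ : ι → ZFSet.{u} => t := .const rfl
  exact ⟨t, mem_omegaSeq.2 ⟨_, rfl⟩, hst ▸ mem_dcl_iff_definableFun (ι := Empty).2 inferInstance⟩

theorem codesSequences_powersetOmega : CodesSequences powersetOmega.{u} := by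
  intro s
  let t : ZFSet.{u} := ZFSet.omega.sep fun x => ∃ n k, x = nat (Nat.pair n k) ∧ nat k ∈ (s n).1
  have mem_t (n k : ℕ) : nat (Nat.pair n k) ∈ t ↔ nat k ∈ (s n).1 := by
    simp only [t, ZFSet.mem_sep, nat_mem_omega, true_and, nat_inj, Nat.pair_eq_pair]
    exact ⟨fun ⟨_, _, ⟨hn, hk⟩, h⟩ => hn ▸ hk ▸ h, fun h => ⟨n, k, ⟨rfl, rfl⟩, h⟩⟩
  have hst : seq (fun n => s n) =
      omegaFun fun x => ZFSet.omega.sep fun y => natPair x y ∈ t := by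
    refine congrArg seq (funext fun n => ZFSet.ext fun y => ?_)
    rw [ZFSet.mem_sep]
    have hsub := ZFSet.mem_powerset.1 (s n).2
    constructor
    · intro hy
      obtain ⟨k, rfl⟩ := mem_omega_iff.1 (hsub hy)
      exact ⟨hsub hy, by rwa [natPair_nat, mem_t]⟩
    · rintro ⟨hyω, hy⟩
      obtain ⟨k, rfl⟩ := mem_omega_iff.1 hyω
      rwa [natPair_nat, mem_t] at hy
  have ht {ι : Type} : DefinableFun {t} fun _ : ι → ZFSet.{u} => t := .const rfl
  exact ⟨t, ZFSet.mem_powerset.2 ZFSet.sep_subset,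
    hst ▸ mem_dcl_iff_definableFun (ι := Empty).2 inferInstance⟩

theorem codesSequences_singleton_empty : CodesSequences ({∅} : Set ZFSet.{u}) := by
  intro s
  have hs : seq (fun n => s n) = omegaFun fun _ => ∅ :=
    congrArg seq (funext fun n => (s n).2)
  exact ⟨∅, rfl, hs ▸ mem_dcl_iff_definableFun (ι := Empty).2 inferInstance⟩

theorem CodesSequences.exists_mem_OD_singleton [Nonempty X] (hX : CodesSequences X)
    (hx : x ∈ OD X) : ∃ t ∈ X, x ∈ OD {t} := by
  obtain ⟨p, hpX, hxp⟩ := mem_dcl_iff_exists_finset.1 hx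
  obtain ⟨s, hs⟩ := Set.countable_iff_exists_subset_range.1
    (p.countable_toSet.preimage (Subtype.val_injective (p := (· ∈ X))))
  obtain ⟨t, htX, ht⟩ := hX s
  refine ⟨t, htX, dcl_subset_dcl (fun y hy => ?_) hxp⟩
  rcases hpX hy with hyo | hyX
  · exact subset_dcl (.inl hyo)
  · obtain ⟨n, hn⟩ := hs (show ⟨y, hyX⟩ ∈ _ from hy)
    have := mem_dcl_iff_definableFun (ι := Empty).1
      (dcl_mono (Set.subset_union_right (s := {x | x.IsOrdinal})) ht)
    have happ : app (seq fun n => s n) (nat n) = y := (app_seq _ n).trans (congrArg _ hn)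
    exact happ ▸ mem_dcl_iff_definableFun (ι := Empty).2 inferInstance

theorem OD_empty : OD (∅ : Set ZFSet.{u}) = OD {∅} := by
  rw [OD_eq_dcl, OD_eq_dcl, Set.union_empty, Set.union_eq_self_of_subset_right]
  exact Set.singleton_subset_iff.2 ZFSet.isOrdinal_empty

end Sequences

section HereditarilyDefinable

variable {X : Set ZFSet.{u}} {a b x y : ZFSet.{u}}

theorem mem_tcl_singleton_iff :
    b ∈ tcl {a} ↔ ∀ t : ZFSet.{u}, t.IsTransitive → a ∈ t → b ∈ t :=
  forall₂_congr fun _ _ => by simp [ZFSet.subset_def]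

theorem mem_tcl_singleton_iff_eq_or_exists :
    b ∈ tcl {a} ↔ b = a ∨ ∃ y ∈ a, b ∈ tcl {y} := by
  simp only [mem_tcl_singleton_iff]
  constructor
  · intro hb
    obtain ⟨T, hT, haT⟩ : ∃ T : ZFSet.{u}, T.IsTransitive ∧ a ∈ T :=
      (ZFSet.exists_mem_vonNeumann a).imp' _ fun o ho => ⟨ZFSet.isTransitive_vonNeumann o, ho⟩
    let t := T.sep fun b => b = a ∨ ∃ y ∈ a, ∀ t : ZFSet.{u}, t.IsTransitive → y ∈ t → b ∈ t
    have ht : t.IsTransitive := by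
      intro z hz w hwz
      obtain ⟨hzT, hza⟩ := ZFSet.mem_sep.1 hz
      refine ZFSet.mem_sep.2 ⟨hT.mem_trans hwz hzT, .inr ?_⟩
      rcases hza with rfl | ⟨y, hya, hzy⟩
      · exact ⟨w, hwz, fun _ _ h => h⟩
      · exact ⟨y, hya, fun t ht hyt => ht.mem_trans hwz (hzy t ht hyt)⟩
    exact (ZFSet.mem_sep.1 (hb t ht (ZFSet.mem_sep.2 ⟨haT, .inl rfl⟩))).2
  · rintro (rfl | ⟨y, hya, hby⟩) t ht hat
    · exact hat
    · exact hby t ht (ht.mem_trans hya hat)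

theorem mem_HOD_iff : a ∈ HOD X ↔ a ∈ OD X ∧ ∀ y ∈ a, y ∈ HOD X := by
  simp only [HOD, Set.mem_ofPred_eq, Set.subset_def, mem_tcl_singleton_iff_eq_or_exists (a := a)]
  exact ⟨fun h => ⟨h a (.inl rfl), fun y hy b hb => h b (.inr ⟨y, hy, hb⟩)⟩,
    fun h b hb => hb.elim (fun hba => hba ▸ h.1) fun ⟨y, hy, hb⟩ => h.2 y hy b hb⟩

theorem mem_HOD_of_mem (ha : a ∈ HOD X) (hy : y ∈ a) : y ∈ HOD X :=
  (mem_HOD_iff.1 ha).2 y hy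

theorem mem_OD_of_mem_HOD (ha : a ∈ HOD X) : a ∈ OD X := (mem_HOD_iff.1 ha).1

theorem unorderedPair_mem_HOD (hx : x ∈ HOD X) (hy : y ∈ HOD X) : {x, y} ∈ HOD X := by
  refine mem_HOD_iff.2 ⟨?_, fun z hz => ?_⟩
  · exact DefinableFun.mem_dcl (f := fun v : Fin 2 → ZFSet.{u} => {v 0, v 1}) inferInstance
      (p := ![x, y]) (Fin.forall_fin_two.2 ⟨mem_OD_of_mem_HOD hx, mem_OD_of_mem_HOD hy⟩)
  · rcases ZFSet.mem_pair.1 hz with rfl | rfl <;> assumption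

theorem pair_mem_HOD (hx : x ∈ HOD X) (hy : y ∈ HOD X) : ZFSet.pair x y ∈ HOD X :=
  unorderedPair_mem_HOD (ZFSet.pair_eq_singleton x ▸ unorderedPair_mem_HOD hx hx)
    (unorderedPair_mem_HOD hx hy)

theorem nat_mem_HOD (n : ℕ) : nat n ∈ HOD X := by
  induction n with
  | zero => exact mem_HOD_iff.2 ⟨subset_dcl (.inl (isOrdinal_nat 0)), by simp [nat_zero]⟩
  | succ n ih =>
    refine mem_HOD_iff.2 ⟨subset_dcl (.inl (isOrdinal_nat (n + 1))), fun y hy => ?_⟩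
    rcases ZFSet.mem_insert_iff.1 (nat_succ n ▸ hy) with rfl | hy
    · exact ih
    · exact mem_HOD_of_mem ih hy

theorem omega_mem_HOD : ZFSet.omega ∈ HOD X :=
  mem_HOD_iff.2 ⟨mem_dcl_iff_definableFun (ι := Empty).2 inferInstance,
    forall_mem_omega.2 nat_mem_HOD⟩

theorem seq_mem_HOD {g : ℕ → ZFSet.{u}} (hseq : seq g ∈ OD X) (hg : ∀ n, g n ∈ HOD X) :
    seq g ∈ HOD X :=
  mem_HOD_iff.2 ⟨hseq, fun p hp => by
    obtain ⟨n, rfl⟩ := mem_seq.1 hp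
    exact pair_mem_HOD (nat_mem_HOD n) (hg n)⟩

end HereditarilyDefinable

section DependentChoice

variable {X : Set ZFSet.{u}} {a r : ZFSet.{u}}

theorem seq_eq_recSeq {F : ZFSet.{u} → ZFSet.{u} → ZFSet.{u}} {g : ℕ → ZFSet.{u}}
    (hg : ∀ n, g (n + 1) = F (nat n) (g n)) : seq g = recSeq F (g 0) := by
  refine congrArg seq (funext fun n => ?_)
  induction n with
  | zero => rfl
  | succ n ih => rw [hg, ih]

theorem seq_mem_OD_of_eq_chosen {t g : ℕ → ZFSet.{u}} (ha : a ∈ OD X) (hr : r ∈ OD X)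
    (ht : seq t ∈ OD X) (hg₀ : g 0 ∈ OD X)
    (hg : ∀ n, g (n + 1) = chosen (a.sep fun y => ZFSet.pair y (g n) ∈ r) (t n)) :
    seq g ∈ OD X := by
  rw [seq_eq_recSeq (F := fun n x => chosen (a.sep fun y => ZFSet.pair y x ∈ r) (app (seq t) n))
    fun n => (hg n).trans (by rw [app_seq])]
  exact DefinableFun.mem_dcl (ι := Fin 4) (p := ![a, r, seq t, g 0])
    (f := fun v => recSeq
      (fun n x => chosen ((v 0).sep fun y => ZFSet.pair y x ∈ v 1) (app (v 2) n)) (v 3))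
    inferInstance (by simpa [Fin.forall_fin_succ, ← OD_eq_dcl] using ⟨ha, hr, ht, hg₀⟩)

theorem CodesSequences.exists_seq_mem_HOD [Nonempty X] (hX : CodesSequences X)
    (ha : a ∈ HOD X) (hr : r ∈ OD X) (hne : ∃ x, x ∈ a)
    (hstep : ∀ x ∈ a, ∃ y ∈ a, ZFSet.pair y x ∈ r) :
    ∃ g : ℕ → ZFSet.{u}, (∀ n, g n ∈ a) ∧ (∀ n, ZFSet.pair (g (n + 1)) (g n) ∈ r) ∧
      seq g ∈ HOD X := by
  let succs (x : ZFSet.{u}) : ZFSet.{u} := a.sep fun y => ZFSet.pair y x ∈ r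
  have hnext (x : {x // x ∈ a}) : ∃ t : X, chosen (succs x) t ∈ succs x := by
    obtain ⟨y, hy, hyx⟩ := hstep x x.2
    obtain ⟨t, htX, hyt⟩ := hX.exists_mem_OD_singleton (mem_OD_of_mem_HOD (mem_HOD_of_mem ha hy))
    exact ⟨⟨t, htX⟩, chosen_mem ⟨y, ZFSet.mem_sep.2 ⟨hy, hyx⟩, hyt⟩⟩
  choose t ht using hnext
  obtain ⟨x₀, hx₀⟩ := hne
  obtain ⟨g, hg⟩ : ∃ g : ℕ → {x // x ∈ a}, ∀ n, (g (n + 1)).1 = chosen (succs (g n)) (t (g n)) :=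
    ⟨fun n => n.rec ⟨x₀, hx₀⟩ fun _ x => ⟨_, (ZFSet.mem_sep.1 (ht x)).1⟩, fun _ => rfl⟩
  have hgH (n : ℕ) : (g n).1 ∈ HOD X := mem_HOD_of_mem ha (g n).2
  have hgr (n : ℕ) : ZFSet.pair (g (n + 1)) (g n) ∈ r :=
    hg n ▸ (ZFSet.mem_sep.1 (ht (g n))).2
  obtain ⟨p, hpX, hp⟩ := hX fun n => t (g n)
  have hseq : seq (fun n => (g n).1) ∈ OD X :=
    seq_mem_OD_of_eq_chosen (mem_OD_of_mem_HOD ha) hr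
      (dcl_mono (Set.singleton_subset_iff.2 (.inr hpX)) hp) (mem_OD_of_mem_HOD (hgH 0)) hg
  exact ⟨fun n => g n, fun n => (g n).2, hgr, seq_mem_HOD hseq hgH⟩

end DependentChoice

section TransitiveClasses

variable {H : Set ZFSet.{u}} (hH : ∀ x ∈ H, ∀ y ∈ x, y ∈ H)
include hH

theorem eq_of_forall_mem_iff {a b : ZFSet.{u}} (ha : a ∈ H) (hb : ∀ z ∈ b, z ∈ H)
    (h : ∀ z : H, z.1 ∈ a ↔ z.1 ∈ b) : a = b :=
  ZFSet.ext fun z => ⟨fun hz => (h ⟨z, hH _ ha _ hz⟩).1 hz, fun hz => (h ⟨z, hb _ hz⟩).2 hz⟩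

theorem isEmptySet_memOn_iff {e : H} : IsEmptySet (memOn H) e ↔ e.1 = ∅ :=
  ⟨fun h => eq_of_forall_mem_iff hH e.2 (by simp) fun z => iff_of_false (h z) (by simp),
    fun h z hz => ZFSet.notMem_empty z.1 (h ▸ hz)⟩

theorem isSucc_memOn_iff {t s : H} : IsSucc (memOn H) t s ↔ t.1 = insert s.1 s.1 := by
  have hmem (z : H) : z.1 ∈ insert s.1 s.1 ↔ memOn H z s ∨ z = s := by
    rw [ZFSet.mem_insert_iff, or_comm, Subtype.ext_iff, memOn]
  constructor
  · refine fun h => eq_of_forall_mem_iff hH t.2 (fun z hz => ?_) fun z => (h z).trans (hmem z).symm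
    rcases ZFSet.mem_insert_iff.1 hz with rfl | hz
    · exact s.2
    · exact hH _ s.2 _ hz
  · intro h z
    rw [← hmem, ← h, memOn]

theorem isPair_memOn_iff {p x y : H} : IsPair (memOn H) p x y ↔ p.1 = ZFSet.pair x y := by
  constructor
  · rintro ⟨s, d, hs, hd, hp⟩
    have hs' : s.1 = {x.1} :=
      eq_of_forall_mem_iff hH s.2 (by simp) fun z => (hs z).trans (by simp [Subtype.ext_iff])
    have hd' : d.1 = {x.1, y.1} :=
      eq_of_forall_mem_iff hH d.2 (by simp) fun z => (hd z).trans (by simp [Subtype.ext_iff])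
    rw [ZFSet.pair, ← hs', ← hd']
    exact eq_of_forall_mem_iff hH p.2 (by simp) fun z => (hp z).trans (by simp [Subtype.ext_iff])
  · intro h
    have hs : {x.1} ∈ H := hH p p.2 _ (by simp [h, ZFSet.pair])
    have hd : {x.1, y.1} ∈ H := hH p p.2 _ (by simp [h, ZFSet.pair])
    refine ⟨⟨_, hs⟩, ⟨_, hd⟩, ?_, ?_, ?_⟩ <;> simp [memOn, h, ZFSet.pair, Subtype.ext_iff]

theorem pairMem_memOn_iff {x y r : H} :
    PairMem (memOn H) x y r ↔ ZFSet.pair x y ∈ r.1 := by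
  constructor
  · rintro ⟨p, hp, h⟩
    exact (isPair_memOn_iff hH).1 h ▸ hp
  · exact fun h => ⟨⟨_, hH _ r.2 _ h⟩, h, (isPair_memOn_iff hH).2 rfl⟩

theorem isOmega_memOn (hω : ZFSet.omega ∈ H) : IsOmega (memOn H) ⟨ZFSet.omega, hω⟩ := by
  have hnat (n : ℕ) : nat n ∈ H := hH _ hω _ (nat_mem_omega n)
  refine ⟨⟨⟨⟨nat 0, hnat 0⟩, nat_mem_omega 0, (isEmptySet_memOn_iff hH).2 nat_zero⟩, ?_⟩, ?_⟩
  · rintro ⟨s, hs⟩ hsω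
    obtain ⟨n, rfl⟩ := mem_omega_iff.1 hsω
    exact ⟨⟨nat (n + 1), hnat _⟩, nat_mem_omega _, (isSucc_memOn_iff hH).2 (nat_succ n)⟩
  · rintro a ⟨⟨e, hea, he⟩, hsucc⟩ ⟨x, hx⟩ hxω
    have mem_a (n : ℕ) : nat n ∈ a.1 := by
      induction n with
      | zero => exact nat_zero ▸ (isEmptySet_memOn_iff hH).1 he ▸ hea
      | succ n ih =>
        obtain ⟨t, hta, ht⟩ := hsucc ⟨nat n, hnat n⟩ ih
        exact nat_succ n ▸ (isSucc_memOn_iff hH).1 ht ▸ hta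
    exact forall_mem_omega.2 mem_a x hxω

theorem isFunction_memOn (hω : ZFSet.omega ∈ H) {a : H} {g : ℕ → ZFSet.{u}}
    (hg : ∀ n, g n ∈ a.1) (hf : seq g ∈ H) :
    IsFunction (memOn H) ⟨seq g, hf⟩ ⟨ZFSet.omega, hω⟩ a := by
  have hgH (n : ℕ) : g n ∈ H := hH _ a.2 _ (hg n)
  constructor
  · rintro ⟨p, hp⟩ hpf
    obtain ⟨n, rfl⟩ := mem_seq.1 hpf
    exact ⟨⟨nat n, hH _ hω _ (nat_mem_omega n)⟩, ⟨g n, hgH n⟩, nat_mem_omega n, hg n,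
      (isPair_memOn_iff hH).2 rfl⟩
  · rintro ⟨x, hx⟩ hxω
    obtain ⟨n, rfl⟩ := mem_omega_iff.1 hxω
    exact ⟨⟨g n, hgH n⟩, (pairMem_memOn_iff hH).2 (by simp), fun y hy =>
      Subtype.ext (pair_mem_seq.1 ((pairMem_memOn_iff hH).1 hy))⟩

theorem satisfiesDC_memOn (hω : ZFSet.omega ∈ H)
    (hDC : ∀ a ∈ H, ∀ r ∈ H, (∃ x, x ∈ a) → (∀ x ∈ a, ∃ y ∈ a, ZFSet.pair y x ∈ r) →
      ∃ g : ℕ → ZFSet.{u}, (∀ n, g n ∈ a) ∧ (∀ n, ZFSet.pair (g (n + 1)) (g n) ∈ r) ∧ seq g ∈ H) :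
    SatisfiesDC (memOn H) := by
  rintro a r ⟨x, hx⟩ hstep
  obtain ⟨g, hga, hgr, hg⟩ := hDC a a.2 r r.2 ⟨x, hx⟩ fun x hx =>
    (hstep ⟨x, hH _ a.2 _ hx⟩ hx).imp' Subtype.val
      fun _ h => ⟨h.1, (pairMem_memOn_iff hH).1 h.2⟩
  refine ⟨⟨ZFSet.omega, hω⟩, ⟨seq g, hg⟩, isOmega_memOn hH hω, isFunction_memOn hH hω hga hg, ?_⟩
  rintro ⟨n, hn⟩ ⟨m, hm⟩ x y hnω hmn hxf hyf
  obtain ⟨n, rfl⟩ := mem_omega_iff.1 hnω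
  obtain rfl : m = nat (n + 1) := ((isSucc_memOn_iff hH).1 hmn).trans (nat_succ n).symm
  have hx : x.1 = g n := pair_mem_seq.1 ((pairMem_memOn_iff hH).1 hxf)
  have hy : y.1 = g (n + 1) := pair_mem_seq.1 ((pairMem_memOn_iff hH).1 hyf)
  exact (pairMem_memOn_iff hH).2 (hx ▸ hy ▸ hgr n)

end TransitiveClasses

theorem CodesSequences.satisfiesDC_memOn_HOD {X : Set ZFSet.{u}} [Nonempty X]
    (hX : CodesSequences X) : SatisfiesDC (memOn (HOD X)) :=
  satisfiesDC_memOn (fun _ ha _ hy => mem_HOD_of_mem ha hy) omega_mem_HOD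
    fun _ ha _ hr => hX.exists_seq_mem_HOD ha (mem_OD_of_mem_HOD hr)

theorem satisfiesDC_memOn_HOD_omegaSeq (M : Set ZFSet.{u}) :
    SatisfiesDC (memOn (HOD (omegaSeq M))) := by
  rcases isEmpty_or_nonempty (omegaSeq M) with h | h
  · rw [Set.isEmpty_coe_sort.1 h, HOD, OD_empty]
    exact codesSequences_singleton_empty.satisfiesDC_memOn_HOD
  · exact (codesSequences_omegaSeq M).satisfiesDC_memOn_HOD

theorem satisfiesDC_memOn_HOD_powersetOmega : SatisfiesDC (memOn (HOD powersetOmega.{u})) :=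
  haveI : Nonempty powersetOmega.{u} := ⟨∅, ZFSet.mem_powerset.2 (ZFSet.empty_subset _)⟩
  codesSequences_powersetOmega.satisfiesDC_memOn_HOD

end HODModels

theorem theorem7p3p2_general :
    (∀ M : Set ZFSet.{u}, HODModels.SatisfiesDC (HODModels.memOn (HODModels.HOD
      (HODModels.omegaSeq M)))) ∧
    HODModels.SatisfiesDC (HODModels.memOn (HODModels.HOD HODModels.powersetOmega.{u})) :=
  ⟨HODModels.satisfiesDC_memOn_HOD_omegaSeq, HODModels.satisfiesDC_memOn_HOD_powersetOmega⟩

theorem theorem7p3p2 :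
    (∀ M : Set ZFSet.{u}, HODModels.IsInnerModel M →
      HODModels.SatisfiesDC (HODModels.memOn (HODModels.HOD (HODModels.omegaSeq M)))) ∧
    HODModels.SatisfiesDC (HODModels.memOn (HODModels.HOD HODModels.powersetOmega.{u})) :=
  ⟨fun M _ => theorem7p3p2_general.1 M, theorem7p3p2_general.2⟩
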